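/- Let $N\ge 2$, let $A_{\mathcal G}=[a_{ij}]\in\mathbb R^{N\times N}$ with $a_{ij}\ge 0$, $a_{ii}=0$ be the adjacency matrix of a weighted digraph and $L_{\mathcal G}=\operatorname{diag}\big(\sum_k a_{1k},\dots,\sum_k a_{Nk}\big)-A_{\mathcal G}$ its Laplacian. Put $$\Theta=\begin{bmatrix}1&0\\-1_{N-1}&I_{N-1}\end{bmatrix},\qquad \Theta L_{\mathcal G}\Theta^{-1}=\begin{bmatrix}0&\tilde l_{12}^{\top}\\0&\tilde L_{22}\end{bmatrix},$$ where $1_k\in\mathbb R^k$ is the vector of ones. Let $S\in\mathbb R^{n_w\times n_w}$ be diagonalizable (over $\mathbb C$) with all eigenvalues on the imaginary axis, let $\tilde q(1),k_v\in\mathbb R^{n_w}$ and $\mu_c\in\mathbb R$ be arbitrary, and set $$F_{\varepsilon_v}=I_{N-1}\otimes S-\tilde L_{22}\otimes \tilde q(1)k_v^{\top},\qquad B=\begin{bmatrix}0\\ I_{N-1}\otimes k_v^{\top}\end{bmatrix}.$$ Consider the leaderless ODE-PDE cascade with state $(\tilde x(\cdot,t),e_{v_1}(t),\varepsilon_v(t))\in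 X=L_2(0,1)^N\oplus\mathbb R^{n_w}\oplus\mathbb R^{(N-1)n_w}$, $$\begin{aligned} \dot{\tilde x}(z,t)&=\tilde x''(z,t)-\mu_c\tilde x(z,t),\quad z\in(0,1),\ t>0,\\ \tilde x'(0,t)&=0,\qquad \tilde x'(1,t)=1_Nk_v^{\top}e_{v_1}(t)+B\varepsilon_v(t),\\ \dot e_{v_1}(t)&=Se_{v_1}(t)-\big(\tilde l_{12}^{\top}\otimes\tilde q(1)k_v^{\top}\big)\varepsilon_v(t),\\ \dot\varepsilon_v(t)&=F_{\varepsilon_v}\varepsilon_v(t). \end{aligned}\tag{1}$$ Solutions are understood in the weak (mild) sense: $\tilde x\in C([0,\infty);L_2(0,1)^N)$, $e_{v_1}$ and $\varepsilon_v$ are continuous on $[0,\infty)$, the ordinary differential equations hold for $t>0$, and for every $\varphi\in C^2[0,1]$ with $\varphi'(0)=\varphi'(1)=0$ and all $t>0$ $$\frac{d}{dt}\int_0^1\tilde x(z,t)\varphi(z)\,dz=\int_0^1\tilde x(z,t)\big(\varphi''(z)-\mu_c\varphi(z)\big)dz+\big(1_Nk_v^{\top}e_{v_1}(t)+B\varepsilon_v(t)\big)\varphi(1).$$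 Let $\sigma_c$ be the set of eigenvalues of $h\mapsto h''-\mu_c h$ on $(0,1)$ for $\mathbb C^N$-valued $h$ with $h'(0)=h'(1)=0$, and assume $$\sigma(F_{\varepsilon_v})\cap\sigma(S)=\emptyset,\qquad \sigma_c\cap\sigma(S)=\emptyset,\qquad \sigma_c\cap\sigma(F_{\varepsilon_v})=\emptyset .$$ Assume moreover that the homogeneous Neumann system $\dot{\bar x}=\bar x''-\mu_c\bar x$, $\bar x'(0,t)=\bar x'(1,t)=0$ is exponentially stable (there are $M\ge 1$, $\alpha>0$ with $\|\bar x(t)\|_{L_2}\le Me^{-\alpha t}\|\bar x(0)\|_{L_2}$, $t\ge 0$, for all its solutions in the above sense), and that $F_{\varepsilon_v}$ is Hurwitz. Then: (i) there exist unique $\Pi\in\mathbb R^{n_w\times (N-1)n_w}$ and $\Sigma_1:[0,1]\to\mathbb R^{N\times n_w}$, $\Sigma_2:[0,1]\to\mathbb R^{N\times(N-1)n_w}$ of class $C^2$ such that $$\begin{aligned} &\Pi F_{\varepsilon_v}-S\Pi=-\big(\tilde l_{12}^{\top}\otimes\tilde q(1)k_v^{\top}\big),\\ &\Sigma_1''-\mu_c\Sigma_1-\Sigma_1S=0\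 \text{on }(0,1),\quad \Sigma_1'(0)=0,\quad \Sigma_1'(1)=1_Nk_v^{\top},\\ &\Sigma_2''-\mu_c\Sigma_2-\Sigma_2F_{\varepsilon_v}=0\ \text{on }(0,1),\quad \Sigma_2'(0)=0,\quad \Sigma_2'(1)=1_Nk_v^{\top}\Pi+B; \end{aligned}$$ (ii) for every initial state in $X$ the cascade (1) has exactly one solution on $[0,\infty)$; (iii) every solution of (1) is bounded: $\sup_{t\ge 0}\big(\|\tilde x(t)\|_{L_2}^2+\|e_{v_1}(t)\|^2+\|\varepsilon_v(t)\|^2\big)^{1/2}<\infty$; (iv) for every solution of (1), with $\tilde e_{v_1}(t)=e_{v_1}(t)-\Pi\varepsilon_v(t)$, $$\lim_{t\to\infty}\big\|\tilde x(\cdot,t)-\Sigma_1(\cdot)\,\tilde e_{v_1}(t)\big\|_{L_2}=0 .$$ -/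

import Mathlib

open MeasureTheory Set Filter Topology
open scoped Kronecker Matrix

namespace NetSync

/-! Agents are indexed by `Fin (m + 1)`, so that `N = m + 1`; agent `1` of the text is the index
`0`, and the agents `2, …, N` are the indices `Fin.succ j`, `j : Fin m`. The signal model has
dimension `n`. The aggregated vector `ε_v = col(ε_{v_2}, …, ε_{v_N})` is a function on
`Fin m × Fin n`. -/

/-- Graph Laplacian `D - A` of the weighted digraph with adjacency matrix `A`. -/
noncomputable def laplacian {N : ℕ} (A : Matrix (Fin N) (Fin N) ℝ) : Matrix (Fin N) (Fin N) ℝ :=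
  Matrix.diagonal (fun i => ∑ j, A i j) - A

/-- `Θ = [[1, 0], [-1_{N-1}, I_{N-1}]]`. -/
def Theta (m : ℕ) : Matrix (Fin (m + 1)) (Fin (m + 1)) ℝ :=
  Matrix.of fun i j => if i = j then 1 else if j = 0 then -1 else 0

/-- `Θ L Θ⁻¹`, with `L` the Laplacian. -/
noncomputable def Ltilde {m : ℕ} (A : Matrix (Fin (m + 1)) (Fin (m + 1)) ℝ) :
    Matrix (Fin (m + 1)) (Fin (m + 1)) ℝ :=
  Theta m * laplacian A * (Theta m)⁻¹

/-- Upper right block (a row) of `Θ L Θ⁻¹`. -/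
noncomputable def l12 {m : ℕ} (A : Matrix (Fin (m + 1)) (Fin (m + 1)) ℝ) : Fin m → ℝ :=
  fun j => Ltilde A 0 j.succ

/-- Lower right block of `Θ L Θ⁻¹`. -/
noncomputable def L22 {m : ℕ} (A : Matrix (Fin (m + 1)) (Fin (m + 1)) ℝ) :
    Matrix (Fin m) (Fin m) ℝ :=
  Matrix.of fun i j => Ltilde A i.succ j.succ

/-- `F_ε = I_{N-1} ⊗ S - L22 ⊗ q kᵀ`. -/
noncomputable def Feps {m n : ℕ} (A : Matrix (Fin (m + 1)) (Fin (m + 1)) ℝ)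
    (S : Matrix (Fin n) (Fin n) ℝ) (q k : Fin n → ℝ) :
    Matrix (Fin m × Fin n) (Fin m × Fin n) ℝ :=
  (1 : Matrix (Fin m) (Fin m) ℝ) ⊗ₖ S - L22 A ⊗ₖ Matrix.vecMulVec q k

/-- The coupling matrix `l12ᵀ ⊗ q kᵀ`. -/
noncomputable def coupling {m n : ℕ} (A : Matrix (Fin (m + 1)) (Fin (m + 1)) ℝ)
    (q k : Fin n → ℝ) : Matrix (Fin n) (Fin m × Fin n) ℝ :=
  Matrix.of fun a p => l12 A p.1 * Matrix.vecMulVec q k a p.2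

/-- `1_N kᵀ`. -/
def oneK (m : ℕ) {n : ℕ} (k : Fin n → ℝ) : Matrix (Fin (m + 1)) (Fin n) ℝ :=
  Matrix.vecMulVec (fun _ => 1) k

/-- `B = [0; I_{N-1} ⊗ kᵀ]`. -/
def Bmat (m : ℕ) {n : ℕ} (k : Fin n → ℝ) : Matrix (Fin (m + 1)) (Fin m × Fin n) ℝ :=
  Matrix.of fun i p => if i = p.1.succ then k p.2 else 0

/-- The complex spectrum of a real matrix. -/
def cspec {ι : Type*} [Fintype ι] [DecidableEq ι] (M : Matrix ι ι ℝ) : Set ℂ :=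
  spectrum ℂ (M.map (fun r : ℝ => (r : ℂ)))

/-- All eigenvalues have negative real part. -/
def IsHurwitz {ι : Type*} [Fintype ι] [DecidableEq ι] (M : Matrix ι ι ℝ) : Prop :=
  ∀ s ∈ cspec M, s.re < 0

/-- Diagonalizable over `ℂ`. -/
def IsDiagonalizable {ι : Type*} [Fintype ι] [DecidableEq ι] (M : Matrix ι ι ℝ) : Prop :=
  ∃ (P : Matrix ι ι ℂ) (d : ι → ℂ), IsUnit P.det ∧
    M.map (fun r : ℝ => (r : ℂ)) * P = P * Matrix.diagonal d

/-- Eigenvalue spectrum of `h ↦ h'' - μ h` on `(0,1)` with `h'(0) = h'(1) = 0`, for functions with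
values in `ℂ^N`. Eigenfunctions in `H²` are automatically `C²` on `[0,1]`. -/
def neumannSpectrum (N : ℕ) (μ : ℝ) : Set ℂ :=
  {s | ∃ h : ℝ → Fin N → ℂ, ContDiffOn ℝ 2 h (Icc 0 1) ∧
    (∃ z ∈ Icc (0 : ℝ) 1, h z ≠ 0) ∧
    derivWithin h (Icc 0 1) 0 = 0 ∧ derivWithin h (Icc 0 1) 1 = 0 ∧
    ∀ z ∈ Ioo (0 : ℝ) 1,
      derivWithin (derivWithin h (Icc 0 1)) (Icc 0 1) z - (μ : ℂ) • h z = s • h z}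

/-- Entrywise derivative on `[0,1]` (one-sided at the end points) of a matrix-valued function. -/
noncomputable def matDeriv {ι κ : Type*} (M : ℝ → Matrix ι κ ℝ) : ℝ → Matrix ι κ ℝ :=
  fun z => Matrix.of fun i j => derivWithin (fun s => M s i j) (Icc 0 1) z

/-- `X'' - μ X - X F = 0` on `(0,1)`, `X'(0) = 0`, `X'(1) = G`, with `X` of class `C²` on `[0,1]`. -/
structure SolvesSigma {ι κ : Type*} [Fintype κ] (μ : ℝ) (F : Matrix κ κ ℝ) (G : Matrix ι κ ℝ)
    (X : ℝ → Matrix ι κ ℝ) : Prop where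
  smooth : ∀ i j, ContDiffOn ℝ 2 (fun z => X z i j) (Icc 0 1)
  ode : ∀ z ∈ Ioo (0 : ℝ) 1, matDeriv (matDeriv X) z - μ • X z - X z * F = 0
  left : matDeriv X 0 = 0
  right : matDeriv X 1 = G

/-- The system of matrix equations that determines `Π`, `Σ₁`, `Σ₂`. -/
structure SolvesTransform {m n : ℕ} (A : Matrix (Fin (m + 1)) (Fin (m + 1)) ℝ)
    (S : Matrix (Fin n) (Fin n) ℝ) (q k : Fin n → ℝ) (μ : ℝ)
    (P : Matrix (Fin n) (Fin m × Fin n) ℝ)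
    (X₁ : ℝ → Matrix (Fin (m + 1)) (Fin n) ℝ)
    (X₂ : ℝ → Matrix (Fin (m + 1)) (Fin m × Fin n) ℝ) : Prop where
  sylvester : P * Feps A S q k - S * P = -coupling A q k
  sigma₁ : SolvesSigma μ S (oneK m k) X₁
  sigma₂ : SolvesSigma μ (Feps A S q k) (oneK m k * P + Bmat m k) X₂

/-- The space `L²(0,1)^N` with the norm `(∫₀¹ ‖h(z)‖² dz)^{1/2}`. -/
abbrev L2 (N : ℕ) : Type := Lp (EuclideanSpace ℝ (Fin N)) 2 (volume.restrict (Ioo (0 : ℝ) 1))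

/-- `C²` test functions satisfying the homogeneous Neumann conditions. -/
structure IsTest (φ : ℝ → ℝ) : Prop where
  smooth : ContDiff ℝ 2 φ
  left : deriv φ 0 = 0
  right : deriv φ 1 = 0

/-- `x : [0,∞) → L²(0,1)^N` is the (weak, equivalently mild) solution of
`ẋ(z,t) = x''(z,t) - μ x(z,t)`, `x'(0,t) = 0`, `x'(1,t) = u(t)`, `t > 0`, continuous in time
up to `t = 0`. The boundary conditions enter through the integration by parts
`∫ x'' φ = u φ(1) + ∫ x φ''`. -/
structure IsNeumannSolution {N : ℕ} (μ : ℝ) (u : ℝ → Fin N → ℝ) (x : ℝ → L2 N) : Prop where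
  cont : ContinuousOn x (Ici 0)
  weak : ∀ φ : ℝ → ℝ, IsTest φ → ∀ i : Fin N, ∀ t > (0 : ℝ),
    HasDerivAt (fun s => ∫ z in Ioo (0 : ℝ) 1, (x s z) i * φ z)
      ((∫ z in Ioo (0 : ℝ) 1, (x t z) i * (deriv (deriv φ) z - μ * φ z)) + u t i * φ 1) t

/-- Exponential stability in `L²` of `ẋ = x'' - μ x`, `x'(0,t) = x'(1,t) = 0`. -/
def IsExpStable (N : ℕ) (μ : ℝ) : Prop :=
  ∃ M ≥ (1 : ℝ), ∃ α > (0 : ℝ), ∀ x : ℝ → L2 N, IsNeumannSolution μ (fun _ _ => 0) x →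
    ∀ t ≥ (0 : ℝ), ‖x t‖ ≤ M * Real.exp (-α * t) * ‖x 0‖

/-- `(x, e, ε)` solves the ODE-PDE cascade
`ẋ = x'' - μ x`, `x'(0,t) = 0`, `x'(1,t) = 1_N kᵀ e(t) + B ε(t)`,
`ė = S e - (l12ᵀ ⊗ q kᵀ) ε`, `ε̇ = F_ε ε`. -/
structure IsCascadeSolution {m n : ℕ} (A : Matrix (Fin (m + 1)) (Fin (m + 1)) ℝ)
    (S : Matrix (Fin n) (Fin n) ℝ) (q k : Fin n → ℝ) (μ : ℝ)
    (x : ℝ → L2 (m + 1)) (e : ℝ → Fin n → ℝ) (ε : ℝ → Fin m × Fin n → ℝ) : Prop where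
  pde : IsNeumannSolution μ (fun t => oneK m k *ᵥ e t + Bmat m k *ᵥ ε t) x
  e_cont : ContinuousOn e (Ici 0)
  e_ode : ∀ t > (0 : ℝ), HasDerivAt e (S *ᵥ e t - coupling A q k *ᵥ ε t) t
  eps_cont : ContinuousOn ε (Ici 0)
  eps_ode : ∀ t > (0 : ℝ), HasDerivAt ε (Feps A S q k *ᵥ ε t) t

/-- Norm of the state `(x, e, ε)` in `L²(0,1)^N ⊕ ℝ^n ⊕ ℝ^{(N-1)n}`. -/
noncomputable def stateNorm {m n : ℕ} (x : L2 (m + 1)) (e : Fin n → ℝ)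
    (ε : Fin m × Fin n → ℝ) : ℝ :=
  Real.sqrt (‖x‖ ^ 2 + ∑ a, e a ^ 2 + ∑ p, ε p ^ 2)

end NetSync

/-!
The cascade is block triangular, and its two finite-dimensional subsystems can be removed by a
change of variables. A solution `P` of the Sylvester equation decouples `e - P ε`, which then obeys the
signal model `S` alone, from `ε`. If `X'' - μ X = X F` with `X'(0) = 0` and `X'(1) = G`, then
`X(z) y(t)` solves the heat equation with boundary input `G y(t)` whenever `y' = F y`
(`SolvesSigma.isNeumannSolution`, which is Green's formula). Hence `x - X₁ (e - P ε) - X₂ ε` solves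
the homogeneous Neumann problem, and exponential stability together with the decay of `ε` gives the
convergence to `X₁ (e - P ε)`; the boundedness follows since in the
eigencoordinates of `S` every component of `e - P ε` keeps its modulus. Uniqueness of `x` is the
stability estimate applied to the difference of two solutions.

Existence needs the homogeneous problem to be solvable for every initial datum
(`exists_isNeumannSolution`). The stability estimate makes the subspace of solvable data closed in
`L²`: solutions with convergent data converge uniformly in time. It contains all modes
`cos (k π z) eᵢ`, and these have a trivial orthogonal complement
(`ae_eq_zero_of_integral_cos_eq_zero`, by Weierstrass approximation in the variable `cos (π z)`).

The completeness of the cosines also settles the boundary value problems for `X₁` and `X₂`. The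
cosine coefficients of a solution of the homogeneous problem are annihilated by the matrices
`F + μ + (k π)²`, which are invertible because `-(k π)² - μ` is a Neumann eigenvalue and not an
eigenvalue of `F`; so solutions are unique. Existence follows by shooting from `z = 0`, since an
injective linear endomorphism of `ℝ^κ` is surjective. The Sylvester equation is treated in the same
way: for disjoint spectra the characteristic polynomial of `F` is invertible at `S`, and
`P F = S P` forces `P = 0`.
-/

namespace NetSync

/-! ### Linear differential equations -/

section LinearODE

variable {E : Type*} [NormedAddCommGroup E] [NormedSpace ℝ E] [CompleteSpace E]

theorem hasDerivAt_exp_smul_apply (L : E →L[ℝ] E) (v : E) (t : ℝ) :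
    HasDerivAt (fun s : ℝ => NormedSpace.exp (s • L) v) (L (NormedSpace.exp (t • L) v)) t := by
  have h := hasDerivAt_exp_smul_const' (𝕂 := ℝ) L t
  simpa using h.clm_apply (hasDerivAt_const t v)

/-- A solution on `(0, ∞)` that is continuous up to `0` is the exponential flow: it becomes
constant after multiplication by `exp (-t L)`. -/
theorem eq_exp_smul_apply_of_hasDerivAt (L : E →L[ℝ] E) {y : ℝ → E} (hc : ContinuousOn y (Ici 0))
    (hd : ∀ t > (0 : ℝ), HasDerivAt y (L (y t)) t) {t : ℝ} (ht : 0 ≤ t) :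
    y t = NormedSpace.exp (t • L) (y 0) := by
  have hinv : ∀ s : ℝ, NormedSpace.exp (s • L) * NormedSpace.exp (s • (-L)) = 1 := by
    intro s
    have hcomm : Commute (s • L) (s • (-L)) := by
      rw [smul_neg]; exact (Commute.refl _).neg_right
    rw [← NormedSpace.exp_add_of_commute_of_mem_ball (𝕂 := ℝ) hcomm
      ((NormedSpace.expSeries_radius_eq_top ℝ (E →L[ℝ] E)).symm ▸ edist_lt_top _ _)
      ((NormedSpace.expSeries_radius_eq_top ℝ (E →L[ℝ] E)).symm ▸ edist_lt_top _ _)]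
    simp
  set g : ℝ → E := fun s => NormedSpace.exp (s • (-L)) (y s) with hg
  have hexp : ∀ s, HasDerivAt (fun s : ℝ => NormedSpace.exp (s • (-L)))
      (NormedSpace.exp (s • (-L)) * (-L)) s :=
    fun s => hasDerivAt_exp_smul_const (𝕂 := ℝ) (-L) s
  have hg' : ∀ s > (0 : ℝ), HasDerivAt g 0 s := by
    intro s hs
    refine ((hexp s).clm_apply (hd s hs)).congr_deriv ?_
    simp
  have hgc : ContinuousOn g (Ici 0) := by
    refine ContinuousOn.clm_apply ?_ hc
    exact fun s _ => (hexp s).continuousAt.continuousWithinAt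
  have hconst : ∀ s > (0 : ℝ), g s = g 0 := by
    intro s hs
    have h1 : Tendsto g (𝓝[>] 0) (𝓝 (g 0)) :=
      (hgc 0 self_mem_Ici).mono_left (nhdsWithin_mono _ Ioi_subset_Ici_self)
    have h2 : ∀ r ∈ Ioi (0 : ℝ), g r = g s := fun r hr =>
      isOpen_Ioi.is_const_of_deriv_eq_zero (convex_Ioi 0).isPreconnected
        (fun r hr => (hg' r hr).differentiableAt.differentiableWithinAt)
        (fun r hr => (hg' r hr).deriv) hr hs
    have h3 : Tendsto g (𝓝[>] 0) (𝓝 (g s)) :=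
      tendsto_const_nhds.congr' (by
        filter_upwards [self_mem_nhdsWithin] with r hr using (h2 r hr).symm)
    exact tendsto_nhds_unique h3 h1
  have hg0 : g t = y 0 := by
    have : g 0 = y 0 := by simp [hg]
    rcases ht.eq_or_lt with rfl | ht
    · exact this
    · rw [hconst t ht, this]
  rw [← hg0, hg]
  exact (congrArg (fun T : E →L[ℝ] E => T (y t)) (hinv t)).symm

end LinearODE

section MatrixODE

variable {κ : Type*} [Fintype κ]

theorem hasDerivAt_const_mulVec {𝕜 ι : Type*} [RCLike 𝕜] [Fintype ι] (N : Matrix ι κ 𝕜)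
    {w : ℝ → κ → 𝕜} {w' : κ → 𝕜} {t : ℝ} (hw : HasDerivAt w w' t) :
    HasDerivAt (fun t => N *ᵥ w t) (N *ᵥ w') t := by
  rw [hasDerivAt_pi] at hw ⊢
  exact fun i => HasDerivAt.fun_sum fun j _ => (hw j).const_mul (N i j)

theorem exists_hasDerivAt_mulVec (M : Matrix κ κ ℝ) (v : κ → ℝ) :
    ∃ y : ℝ → κ → ℝ, y 0 = v ∧ ∀ t, HasDerivAt y (M *ᵥ y t) t := by
  refine ⟨fun t => NormedSpace.exp (t • LinearMap.toContinuousLinearMap M.mulVecLin) v, ?_,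
    fun t => ?_⟩
  · simp
  · exact hasDerivAt_exp_smul_apply (LinearMap.toContinuousLinearMap M.mulVecLin) v t

theorem eq_of_hasDerivAt_mulVec (M : Matrix κ κ ℝ) {y y' : ℝ → κ → ℝ}
    (hc : ContinuousOn y (Ici 0)) (hd : ∀ t > (0 : ℝ), HasDerivAt y (M *ᵥ y t) t)
    (hc' : ContinuousOn y' (Ici 0)) (hd' : ∀ t > (0 : ℝ), HasDerivAt y' (M *ᵥ y' t) t)
    (h0 : y 0 = y' 0) {t : ℝ} (ht : 0 ≤ t) : y t = y' t := by
  rw [eq_exp_smul_apply_of_hasDerivAt (LinearMap.toContinuousLinearMap M.mulVecLin) hc hd ht,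
    eq_exp_smul_apply_of_hasDerivAt (LinearMap.toContinuousLinearMap M.mulVecLin) hc' hd' ht, h0]

/-! ### Long-time behaviour of linear differential equations -/

/-- A solution of `w' = λ w + u` decays exponentially if `Re λ < 0` and `u` does. -/
theorem exists_exp_decay_of_hasDerivAt {E : Type*} [NormedAddCommGroup E] [NormedSpace ℂ E]
    {w u : ℝ → E} {l : ℂ} (hl : l.re < 0) (hw : ∀ t, HasDerivAt w (l • w t + u t) t)
    {b C : ℝ} (hb : 0 < b) (hu : ∀ t ≥ (0 : ℝ), ‖u t‖ ≤ C * Real.exp (-b * t)) :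
    ∃ b' > (0 : ℝ), ∃ C', ∀ t ≥ (0 : ℝ), ‖w t‖ ≤ C' * Real.exp (-b' * t) := by
  have hC : 0 ≤ C := by simpa using (norm_nonneg _).trans (hu 0 le_rfl)
  -- a rate below both `b` and `-Re λ`
  set r := min b (-l.re / 2) with hr
  have hr0 : 0 < r := lt_min hb (by linarith)
  have hrb : r ≤ b := min_le_left _ _
  have hrl : 0 < -l.re - r := by
    have : r ≤ -l.re / 2 := min_le_right _ _
    linarith
  set c := -l.re - r with hc
  have hexp : ∀ t : ℝ, ‖Complex.exp (-l * t)‖ = Real.exp (-l.re * t) := by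
    intro t; rw [Complex.norm_exp]; simp
  have hf : ∀ t : ℝ, HasDerivAt (fun t : ℝ => Complex.exp (-l * t) • w t)
      (Complex.exp (-l * t) • u t) t := by
    intro t
    have h1 : HasDerivAt (fun t : ℝ => Complex.exp (-l * t)) (Complex.exp (-l * t) * (-l)) t := by
      have := (((hasDerivAt_id (t : ℂ)).const_mul (-l)).cexp).comp_ofReal
      simpa using this
    have h2 := h1.smul (hw t)
    refine h2.congr_deriv ?_
    rw [smul_add, smul_smul, add_right_comm, ← add_smul]
    simp
  refine ⟨r, hr0, ‖w 0‖ + C / c, fun t ht => ?_⟩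
  have key := image_norm_le_of_norm_deriv_right_le_deriv_boundary
    (f := fun t : ℝ => Complex.exp (-l * t) • w t) (a := 0) (b := t)
    (f' := fun t : ℝ => Complex.exp (-l * t) • u t)
    (B := fun t => ‖w 0‖ + C / c * Real.exp (c * t)) (B' := fun t => C * Real.exp (c * t))
    (fun s _ => (hf s).continuousAt.continuousWithinAt)
    (fun s _ => (hf s).hasDerivWithinAt) (by simpa using by positivity)
    (fun s => by
      have h := (((hasDerivAt_id s).const_mul c).exp.const_mul (C / c)).const_add ‖w 0‖
      refine h.congr_deriv ?_
      simp only [id, mul_one]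
      field_simp)
    (fun s hs => by
      rw [norm_smul, hexp]
      calc Real.exp (-l.re * s) * ‖u s‖ ≤ Real.exp (-l.re * s) * (C * Real.exp (-b * s)) := by
            gcongr; exact hu s hs.1
        _ = C * Real.exp ((-l.re - b) * s) := by
            rw [mul_left_comm, ← Real.exp_add]; ring_nf
        _ ≤ C * Real.exp (c * s) := by
            have h0 := hs.1
            have h1 : -l.re - b ≤ c := by linarith
            gcongr)
    (right_mem_Icc.2 ht)
  rw [norm_smul, hexp] at key
  have h1 : ‖w t‖ = Real.exp (l.re * t) * (Real.exp (-l.re * t) * ‖w t‖) := by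
    rw [← mul_assoc, ← Real.exp_add]; simp
  have h2 : 0 ≤ C / c := by positivity
  rw [h1]
  calc Real.exp (l.re * t) * (Real.exp (-l.re * t) * ‖w t‖)
      ≤ Real.exp (l.re * t) * (‖w 0‖ * Real.exp (c * t) + C / c * Real.exp (c * t)) := by
        gcongr
        refine key.trans ?_
        have : 1 ≤ Real.exp (c * t) := Real.one_le_exp (by positivity)
        have := mul_le_mul_of_nonneg_left this (norm_nonneg (w 0))
        linarith
    _ = (‖w 0‖ + C / c) * (Real.exp (l.re * t) * Real.exp (c * t)) := by ring
    _ = (‖w 0‖ + C / c) * Real.exp (-r * t) := by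
        rw [← Real.exp_add, hc]; ring_nf

/-- Induction on the factors of an annihilating polynomial: `(M - λ) w` solves the same equation
and is annihilated by one factor less, and `w' = λ w + (M - λ) w`. -/
theorem exists_exp_decay_of_aeval_eq_zero [DecidableEq κ] (M : Matrix κ κ ℂ) (s : Multiset ℂ) :
    (∀ l ∈ s, l.re < 0) → ∀ w : ℝ → κ → ℂ, (∀ t, HasDerivAt w (M *ᵥ w t) t) →
    (∀ t, Polynomial.aeval M (s.map fun l => Polynomial.X - Polynomial.C l).prod *ᵥ w t = 0) →
    ∃ b > (0 : ℝ), ∃ C, ∀ t ≥ (0 : ℝ), ‖w t‖ ≤ C * Real.exp (-b * t) := by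
  induction s using Multiset.induction with
  | empty =>
    intro _ w _ hp
    refine ⟨1, one_pos, 0, fun t _ => ?_⟩
    have := hp t
    simp at this
    simp [this]
  | cons l s ih =>
    intro hs w hw hp
    set N : Matrix κ κ ℂ := M - Matrix.diagonal fun _ => l with hN
    have hNM : Polynomial.aeval M (Polynomial.X - Polynomial.C l) = N := by
      simp only [map_sub, Polynomial.aeval_X, Polynomial.aeval_C, hN]
      rfl
    have hcomm : N * M = M * N := by
      rw [← hNM]
      simp [sub_mul, mul_sub, Algebra.commutes]
    have hNw : ∀ t, HasDerivAt (fun t => N *ᵥ w t) (M *ᵥ (N *ᵥ w t)) t := by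
      intro t
      refine (hasDerivAt_const_mulVec N (hw t)).congr_deriv ?_
      rw [Matrix.mulVec_mulVec, Matrix.mulVec_mulVec, hcomm]
    obtain ⟨b, hb, C, hC⟩ := ih (fun l' hl' => hs l' (Multiset.mem_cons_of_mem hl'))
      (fun t => N *ᵥ w t) hNw (fun t => by
        have := hp t
        rw [Multiset.map_cons, Multiset.prod_cons, mul_comm, map_mul, hNM,
          ← Matrix.mulVec_mulVec] at this
        exact this)
    refine exists_exp_decay_of_hasDerivAt (hs l (Multiset.mem_cons_self _ _))
      (u := fun t => N *ᵥ w t) (fun t => ?_) hb hC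
    refine (hw t).congr_deriv ?_
    rw [hN, Matrix.sub_mulVec]
    ext i
    simp

theorem hasDerivAt_ofReal_mulVec {M : Matrix κ κ ℝ} {y : ℝ → κ → ℝ}
    {t : ℝ} (hy : HasDerivAt y (M *ᵥ y t) t) :
    HasDerivAt (fun t i => (y t i : ℂ))
      (M.map (fun r : ℝ => (r : ℂ)) *ᵥ fun i => (y t i : ℂ)) t := by
  rw [hasDerivAt_pi] at hy ⊢
  intro i
  refine (hy i).ofReal_comp.congr_deriv ?_
  simp [Matrix.mulVec, dotProduct]

theorem norm_ofReal_pi (v : κ → ℝ) : ‖(fun i => (v i : ℂ))‖ = ‖v‖ := by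
  simp [Pi.norm_def]

/-- Cayley-Hamilton makes the characteristic polynomial an annihilating polynomial with roots in
the open left half plane. -/
theorem exists_exp_decay_of_isHurwitz [DecidableEq κ] {M : Matrix κ κ ℝ} (hM : IsHurwitz M)
    {y : ℝ → κ → ℝ} (hy : ∀ t, HasDerivAt y (M *ᵥ y t) t) :
    ∃ b > (0 : ℝ), ∃ C, ∀ t ≥ (0 : ℝ), ‖y t‖ ≤ C * Real.exp (-b * t) := by
  set Mc := M.map (fun r : ℝ => (r : ℂ)) with hMc
  have hsplit := (IsAlgClosed.splits Mc.charpoly).eq_prod_roots_of_monic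
    (Matrix.charpoly_monic Mc)
  simp_rw [← norm_ofReal_pi]
  exact exists_exp_decay_of_aeval_eq_zero Mc Mc.charpoly.roots
    (fun l hl => hM l (Matrix.mem_spectrum_of_isRoot_charpoly (Polynomial.isRoot_of_mem_roots hl)))
    (fun t i => (y t i : ℂ)) (fun t => hasDerivAt_ofReal_mulVec (hy t))
    (fun t => by rw [← hsplit, Matrix.aeval_self_charpoly, Matrix.zero_mulVec])

theorem le_of_exp_decay {f : ℝ → ℝ} {b C : ℝ} (hf0 : 0 ≤ f 0) (hb : 0 < b)
    (hf : ∀ t ≥ (0 : ℝ), f t ≤ C * Real.exp (-b * t)) {t : ℝ} (ht : 0 ≤ t) : f t ≤ C := by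
  have hC : 0 ≤ C := by simpa using hf0.trans (hf 0 le_rfl)
  have h1 : Real.exp (-b * t) ≤ 1 := Real.exp_le_one_iff.2 (by nlinarith)
  exact (hf t ht).trans (mul_le_of_le_one_right hC h1)

theorem tendsto_const_mul_exp_neg {b : ℝ} (hb : 0 < b) (C : ℝ) :
    Tendsto (fun t : ℝ => C * Real.exp (-b * t)) atTop (𝓝 0) := by
  have : Tendsto (fun t : ℝ => Real.exp (-b * t)) atTop (𝓝 0) :=
    Real.tendsto_exp_atBot.comp (tendsto_id.const_mul_atTop_of_neg (by linarith))
  simpa using this.const_mul C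

/-- In eigencoordinates every component only rotates. -/
theorem exists_norm_le_of_isDiagonalizable [DecidableEq κ] {S : Matrix κ κ ℝ}
    (hS : IsDiagonalizable S) (him : ∀ s ∈ cspec S, s.re = 0) {y : ℝ → κ → ℝ}
    (hy : ∀ t, HasDerivAt y (S *ᵥ y t) t) : ∃ C, ∀ t, ‖y t‖ ≤ C := by
  obtain ⟨Q, d, hQ, hSQ⟩ := hS
  set Sc := S.map (fun r : ℝ => (r : ℂ)) with hSc
  have hQ1 : Q⁻¹ * Q = 1 := Matrix.nonsing_inv_mul Q hQ
  have hQ2 : Q * Q⁻¹ = 1 := Matrix.mul_nonsing_inv Q hQ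
  have hd : ∀ i, (d i).re = 0 := by
    intro i
    refine him _ ?_
    have h := spectrum.units_conjugate (R := ℂ) (a := Matrix.diagonal d) (u := ⟨Q, Q⁻¹, hQ2, hQ1⟩)
    simp only [Units.val_mk, Units.inv_mk] at h
    rw [← hSQ, mul_assoc, hQ2, mul_one, spectrum_diagonal] at h
    rw [cspec, h]
    exact ⟨i, rfl⟩
  have hSQ' : Q⁻¹ * Sc = Matrix.diagonal d * Q⁻¹ := by
    calc Q⁻¹ * Sc = Q⁻¹ * (Sc * Q) * Q⁻¹ := by rw [mul_assoc, mul_assoc, hQ2, mul_one]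
      _ = _ := by rw [hSQ, ← mul_assoc, hQ1, one_mul]
  set w : ℝ → κ → ℂ := fun t i => (y t i : ℂ) with hw
  set z : ℝ → κ → ℂ := fun t => Q⁻¹ *ᵥ w t with hz
  have hz' : ∀ t i, HasDerivAt (fun t => z t i) (d i * z t i) t := by
    intro t i
    have h := hasDerivAt_const_mulVec Q⁻¹ (hasDerivAt_ofReal_mulVec (hy t))
    rw [hasDerivAt_pi] at h
    refine (h i).congr_deriv ?_
    rw [Matrix.mulVec_mulVec, ← hSc, hSQ', ← Matrix.mulVec_mulVec, Matrix.mulVec_diagonal]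
  have hzn : ∀ t i, ‖z t i‖ = ‖z 0 i‖ := by
    intro t i
    have hexp : ∀ t : ℝ, ‖Complex.exp (-d i * t)‖ = 1 := by
      intro t; rw [Complex.norm_exp]; simp [hd]
    have h1 : ∀ t : ℝ, HasDerivAt (fun t : ℝ => Complex.exp (-d i * t) * z t i) 0 t := by
      intro t
      have h1 : HasDerivAt (fun t : ℝ => Complex.exp (-d i * t))
          (Complex.exp (-d i * t) * (-d i)) t := by
        have := (((hasDerivAt_id (t : ℂ)).const_mul (-d i)).cexp).comp_ofReal
        simpa using this
      refine (h1.mul (hz' t i)).congr_deriv ?_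
      ring
    have h2 := is_const_of_deriv_eq_zero (fun t => (h1 t).differentiableAt)
      (fun t => (h1 t).deriv) t 0
    have h3 := congrArg norm h2
    simpa only [norm_mul, hexp, one_mul] using h3
  refine ⟨∑ i, ∑ j, ‖Q i j‖ * ‖z 0 j‖, fun t => ?_⟩
  rw [pi_norm_le_iff_of_nonneg (by positivity)]
  intro i
  have h1 : w t = Q *ᵥ z t := by rw [hz, Matrix.mulVec_mulVec, hQ2, Matrix.one_mulVec]
  have h2 : ‖y t i‖ = ‖w t i‖ := by simp [hw]
  rw [h2, h1]
  calc ‖(Q *ᵥ z t) i‖ ≤ ∑ j, ‖Q i j * z t j‖ := norm_sum_le _ _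
    _ = ∑ j, ‖Q i j‖ * ‖z 0 j‖ := by simp only [norm_mul, hzn]
    _ ≤ _ := Finset.single_le_sum (f := fun i => ∑ j, ‖Q i j‖ * ‖z 0 j‖)
        (fun _ _ => by positivity) (Finset.mem_univ i)

end MatrixODE

/-! ### The Sylvester equation -/

section Sylvester

variable {κ ι : Type*} [Fintype κ] [DecidableEq κ] [Fintype ι] [DecidableEq ι]

theorem isUnit_aeval_prod_X_sub_C (S : Matrix ι ι ℂ) (s : Multiset ℂ)
    (hs : ∀ l ∈ s, l ∉ spectrum ℂ S) :
    IsUnit (Polynomial.aeval S (s.map fun l => Polynomial.X - Polynomial.C l).prod) := by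
  induction s using Multiset.induction with
  | empty => simp
  | cons l s ih =>
    rw [Multiset.map_cons, Multiset.prod_cons, map_mul]
    refine IsUnit.mul ?_ (ih fun l' hl' => hs l' (Multiset.mem_cons_of_mem hl'))
    have h := spectrum.notMem_iff.1 (hs l (Multiset.mem_cons_self _ _))
    rw [← neg_sub, IsUnit.neg_iff] at h
    simpa using h

theorem aeval_mul_of_intertwine {F : Matrix κ κ ℂ} {S : Matrix ι ι ℂ} {P : Matrix ι κ ℂ}
    (h : P * F = S * P) (p : Polynomial ℂ) :
    P * Polynomial.aeval F p = Polynomial.aeval S p * P := by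
  induction p using Polynomial.induction_on' with
  | add p q hp hq => simp only [map_add, Matrix.mul_add, Matrix.add_mul, hp, hq]
  | monomial n a =>
    have hpow : P * F ^ n = S ^ n * P := by
      induction n with
      | zero => simp
      | succ n ih => rw [pow_succ, ← Matrix.mul_assoc, ih, Matrix.mul_assoc, h, pow_succ,
          Matrix.mul_assoc]
    simp only [Polynomial.aeval_monomial, ← Algebra.smul_def, Matrix.mul_smul, Matrix.smul_mul,
      hpow]

/-- If `P F = S P`, then `χ(S) P = P χ(F) = 0` for the characteristic polynomial `χ` of `F`, and
`χ(S)` is invertible when the spectra are disjoint. -/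
theorem eq_zero_of_intertwine {F : Matrix κ κ ℝ} {S : Matrix ι ι ℝ}
    (hFS : cspec F ∩ cspec S = ∅) {P : Matrix ι κ ℝ} (h : P * F = S * P) : P = 0 := by
  set c : Matrix κ κ ℂ := F.map (fun r : ℝ => (r : ℂ)) with hc
  set Sc : Matrix ι ι ℂ := S.map (fun r : ℝ => (r : ℂ)) with hSc
  set Pc : Matrix ι κ ℂ := P.map (fun r : ℝ => (r : ℂ)) with hPc
  have h1 : Pc * c = Sc * Pc := by
    have := congrArg (fun M : Matrix ι κ ℝ => M.map Complex.ofRealHom) h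
    simp only [Matrix.map_mul] at this
    exact this
  have h2 := aeval_mul_of_intertwine h1 c.charpoly
  have hu : IsUnit (Polynomial.aeval Sc c.charpoly) := by
    rw [(IsAlgClosed.splits c.charpoly).eq_prod_roots_of_monic (Matrix.charpoly_monic c)]
    refine isUnit_aeval_prod_X_sub_C Sc _ fun l hl hl' => ?_
    have : l ∈ cspec F ∩ cspec S :=
      ⟨Matrix.mem_spectrum_of_isRoot_charpoly (Polynomial.isRoot_of_mem_roots hl), hl'⟩
    rw [hFS] at this
    exact this
  rw [Matrix.aeval_self_charpoly, Matrix.mul_zero] at h2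
  obtain ⟨u, hu⟩ := hu
  have h3 : Pc = 0 := by
    rw [← hu] at h2
    calc Pc = (↑u⁻¹ * (u : Matrix ι ι ℂ)) * Pc := by rw [Units.inv_mul, Matrix.one_mul]
      _ = 0 := by rw [Matrix.mul_assoc, ← h2, Matrix.mul_zero]
  ext i j
  have := congrFun (congrFun h3 i) j
  simpa [hPc] using this

/-- The Sylvester operator is injective, hence bijective on a finite-dimensional space. -/
theorem existsUnique_sylvester {F : Matrix κ κ ℝ} {S : Matrix ι ι ℝ}
    (hFS : cspec F ∩ cspec S = ∅) (C : Matrix ι κ ℝ) :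
    ∃! P : Matrix ι κ ℝ, P * F - S * P = C := by
  let T : Matrix ι κ ℝ →ₗ[ℝ] Matrix ι κ ℝ :=
    { toFun := fun P => P * F - S * P
      map_add' := fun P Q => by simp only [Matrix.add_mul, Matrix.mul_add]; abel
      map_smul' := fun a P => by simp [smul_sub] }
  have hinj : Function.Injective T := by
    rw [← LinearMap.ker_eq_bot, LinearMap.ker_eq_bot']
    exact fun P hP => eq_zero_of_intertwine hFS (sub_eq_zero.1 hP)
  obtain ⟨P, hP⟩ := LinearMap.injective_iff_surjective.1 hinj C
  exact ⟨P, hP, fun Q hQ => hinj (hQ.trans hP.symm)⟩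

end Sylvester

/-! ### Completeness of the cosine system -/

theorem integrableOn_Ioo_mul {f g : ℝ → ℝ} (hf : IntegrableOn f (Ioo 0 1)) (hg : Continuous g) :
    IntegrableOn (fun z => f z * g z) (Ioo 0 1) := by
  obtain ⟨C, hC⟩ := isCompact_Icc.exists_bound_of_continuousOn (s := Icc (0 : ℝ) 1) hg.continuousOn
  refine Integrable.mul_bdd (c := C) hf hg.aestronglyMeasurable ?_
  filter_upwards [ae_restrict_mem measurableSet_Ioo] with z hz
  exact hC z (Ioo_subset_Icc_self hz)

/-- An integrable function on `(0, 1)` orthogonal to all `cos (k π z)` vanishes: it is orthogonal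
to all polynomials in `cos (π z)`, hence, by Weierstrass approximation in the variable
`cos (π z)`, to all continuous functions. -/
theorem ae_eq_zero_of_integral_cos_eq_zero {f : ℝ → ℝ} (hf : IntegrableOn f (Ioo 0 1))
    (h : ∀ k : ℕ, ∫ z in Ioo (0 : ℝ) 1, f z * Real.cos (k * Real.pi * z) = 0) :
    ∀ᵐ z ∂(volume.restrict (Ioo (0 : ℝ) 1)), f z = 0 := by
  -- integer frequencies let the product formula for cosines run without a case `k = 0`
  have hpow : ∀ n : ℕ, ∀ k : ℤ,
      ∫ z in Ioo (0 : ℝ) 1, f z * (Real.cos (Real.pi * z) ^ n * Real.cos (k * Real.pi * z)) = 0 := by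
    intro n
    induction n with
    | zero =>
      intro k
      rcases Int.natAbs_eq k with hk | hk
      · rw [hk]; simpa using h k.natAbs
      · rw [hk]; simpa using h k.natAbs
    | succ n ih =>
      intro k
      have e : ∀ z : ℝ, f z * (Real.cos (Real.pi * z) ^ (n + 1) * Real.cos (k * Real.pi * z)) =
          f z * (Real.cos (Real.pi * z) ^ n * Real.cos ((k + 1 : ℤ) * Real.pi * z)) * (1 / 2) +
          f z * (Real.cos (Real.pi * z) ^ n * Real.cos ((k - 1 : ℤ) * Real.pi * z)) * (1 / 2) := by
        intro z
        have e1 : ((k + 1 : ℤ) : ℝ) * Real.pi * z = k * Real.pi * z + Real.pi * z := by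
          push_cast; ring
        have e2 : ((k - 1 : ℤ) : ℝ) * Real.pi * z = k * Real.pi * z - Real.pi * z := by
          push_cast; ring
        rw [e1, e2, Real.cos_add, Real.cos_sub]
        ring
      simp_rw [e]
      rw [integral_add, integral_mul_const, integral_mul_const, ih, ih]
      · simp
      · exact (integrableOn_Ioo_mul hf (by fun_prop)).mul_const _
      · exact (integrableOn_Ioo_mul hf (by fun_prop)).mul_const _
  have hpoly : ∀ p : Polynomial ℝ,
      ∫ z in Ioo (0 : ℝ) 1, f z * p.eval (Real.cos (Real.pi * z)) = 0 := by
    intro p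
    induction p using Polynomial.induction_on' with
    | add p q hp hq =>
      simp_rw [Polynomial.eval_add, mul_add]
      rw [integral_add, hp, hq, add_zero]
      · exact integrableOn_Ioo_mul hf (p.continuous.comp (by fun_prop))
      · exact integrableOn_Ioo_mul hf (q.continuous.comp (by fun_prop))
    | monomial n a =>
      have := hpow n 0
      simp only [Int.cast_zero, zero_mul, Real.cos_zero, mul_one] at this
      simp_rw [Polynomial.eval_monomial, mul_left_comm]
      rw [integral_const_mul, this, mul_zero]
  refine ae_eq_zero_of_integral_contDiff_smul_eq_zero (Integrable.locallyIntegrable hf) ?_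
  intro g hg _
  have hgc : Continuous g := hg.continuous
  have hbound : ∀ ε > (0 : ℝ), |∫ z in Ioo (0 : ℝ) 1, f z * g z| ≤
      ε * ∫ z in Ioo (0 : ℝ) 1, |f z| := by
    intro ε hε
    obtain ⟨p, hp⟩ := exists_polynomial_near_of_continuousOn (-1) 1
      (fun x => g (Real.arccos x / Real.pi))
      (hgc.comp (Real.continuous_arccos.div_const _)).continuousOn ε hε
    have hpi : Continuous fun z : ℝ => p.eval (Real.cos (Real.pi * z)) :=
      p.continuous.comp (by fun_prop)
    have h1 : ∫ z in Ioo (0 : ℝ) 1, f z * g z =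
        ∫ z in Ioo (0 : ℝ) 1, (f z * g z - f z * p.eval (Real.cos (Real.pi * z))) := by
      rw [integral_sub (integrableOn_Ioo_mul hf hgc) (integrableOn_Ioo_mul hf hpi), hpoly, sub_zero]
    rw [h1, ← integral_const_mul, ← Real.norm_eq_abs]
    refine norm_integral_le_of_norm_le (Integrable.const_mul (Integrable.abs hf) ε) ?_
    filter_upwards [ae_restrict_mem measurableSet_Ioo] with z hz
    have h2 := hp (Real.cos (Real.pi * z)) ⟨Real.neg_one_le_cos _, Real.cos_le_one _⟩
    have hpz : Real.arccos (Real.cos (Real.pi * z)) / Real.pi = z := by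
      rw [Real.arccos_cos]
      · field_simp
      · have := Real.pi_pos
        have := hz.1
        positivity
      · have := mul_le_mul_of_nonneg_left hz.2.le Real.pi_pos.le
        linarith
    rw [hpz, abs_sub_comm] at h2
    rw [← mul_sub, norm_mul, Real.norm_eq_abs, Real.norm_eq_abs, mul_comm]
    exact mul_le_mul_of_nonneg_right h2.le (abs_nonneg _)
  have h0 : |∫ z in Ioo (0 : ℝ) 1, f z * g z| ≤ 0 := by
    have ht : Tendsto (fun ε : ℝ => ε * ∫ z in Ioo (0 : ℝ) 1, |f z|) (𝓝[>] 0) (𝓝 0) := by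
      have : Tendsto (fun ε : ℝ => ε * ∫ z in Ioo (0 : ℝ) 1, |f z|) (𝓝 0) (𝓝 (0 * _)) :=
        tendsto_id.mul_const _
      rw [zero_mul] at this
      exact this.mono_left nhdsWithin_le_nhds
    exact ge_of_tendsto ht (by filter_upwards [self_mem_nhdsWithin] with ε hε using hbound ε hε)
  simpa [mul_comm] using h0

/-! ### Neumann boundary value problems on the unit interval -/

/-- Passage from ordinary derivatives on the line to one-sided derivatives on `[0, 1]`. -/
theorem contDiffOn_two_and_derivWithin {E : Type*} [NormedAddCommGroup E] [NormedSpace ℝ E]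
    {f f' f'' : ℝ → E} (h1 : ∀ z, HasDerivAt f (f' z) z) (h2 : ∀ z, HasDerivAt f' (f'' z) z)
    (hc : Continuous f'') :
    ContDiffOn ℝ 2 f (Icc 0 1) ∧ (∀ z ∈ Icc (0 : ℝ) 1, derivWithin f (Icc 0 1) z = f' z) ∧
      ∀ z ∈ Icc (0 : ℝ) 1, derivWithin (derivWithin f (Icc 0 1)) (Icc 0 1) z = f'' z := by
  have hu : UniqueDiffOn ℝ (Icc (0 : ℝ) 1) := uniqueDiffOn_Icc one_pos
  have hd : ∀ z ∈ Icc (0 : ℝ) 1, derivWithin f (Icc 0 1) z = f' z := fun z hz =>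
    (h1 z).hasDerivWithinAt.derivWithin (hu z hz)
  refine ⟨?_, hd, fun z hz => ?_⟩
  · have e1 : deriv f = f' := funext fun z => (h1 z).deriv
    have e2 : deriv f' = f'' := funext fun z => (h2 z).deriv
    have h3 : ContDiff ℝ 1 f' := contDiff_one_iff_deriv.2
      ⟨fun z => (h2 z).differentiableAt, by rwa [e2]⟩
    have : ContDiff ℝ (1 + 1) f := contDiff_succ_iff_deriv.2
      ⟨fun z => (h1 z).differentiableAt, by simp, by rwa [e1]⟩
    exact (by simpa [one_add_one_eq_two] using this : ContDiff ℝ 2 f).contDiffOn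
  · rw [derivWithin_congr hd (hd z hz)]
    exact (h2 z).hasDerivWithinAt.derivWithin (hu z hz)

theorem hasDerivAt_cos_mul (a z : ℝ) :
    HasDerivAt (fun z => Real.cos (a * z)) (-a * Real.sin (a * z)) z := by
  have h := ((hasDerivAt_id z).const_mul a).cos
  refine h.congr_deriv ?_
  simp [mul_comm]

theorem hasDerivAt_neg_mul_sin_mul (a z : ℝ) :
    HasDerivAt (fun z => -a * Real.sin (a * z)) (-a ^ 2 * Real.cos (a * z)) z := by
  have h := (((hasDerivAt_id z).const_mul a).sin).const_mul (-a)
  refine h.congr_deriv ?_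
  simp only [id, mul_one]
  ring

theorem isTest_cos (k : ℕ) : IsTest fun z => Real.cos (k * Real.pi * z) where
  smooth := by fun_prop
  left := by rw [(hasDerivAt_cos_mul _ 0).deriv]; simp
  right := by rw [(hasDerivAt_cos_mul _ 1).deriv, mul_one, Real.sin_nat_mul_pi, mul_zero]

theorem deriv_deriv_cos (a : ℝ) :
    deriv (deriv fun z => Real.cos (a * z)) = fun z => -a ^ 2 * Real.cos (a * z) := by
  rw [funext fun z => (hasDerivAt_cos_mul a z).deriv]
  exact funext fun z => (hasDerivAt_neg_mul_sin_mul a z).deriv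

/-- `cos (k π z)` is a Neumann eigenfunction. -/
theorem neg_sq_sub_mem_neumannSpectrum (m k : ℕ) (μ : ℝ) :
    ((-((k : ℝ) * Real.pi) ^ 2 - μ : ℝ) : ℂ) ∈ neumannSpectrum (m + 1) μ := by
  obtain ⟨h1, h2, h3⟩ := contDiffOn_two_and_derivWithin (E := Fin (m + 1) → ℂ)
    (f := fun z _ => ((Real.cos (k * Real.pi * z) : ℝ) : ℂ))
    (f' := fun z _ => ((-(k * Real.pi) * Real.sin (k * Real.pi * z) : ℝ) : ℂ))
    (f'' := fun z _ => ((-(k * Real.pi) ^ 2 * Real.cos (k * Real.pi * z) : ℝ) : ℂ))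
    (fun z => hasDerivAt_pi.2 fun _ => (hasDerivAt_cos_mul _ z).ofReal_comp)
    (fun z => hasDerivAt_pi.2 fun _ => (hasDerivAt_neg_mul_sin_mul _ z).ofReal_comp)
    (by fun_prop)
  refine ⟨_, h1, ⟨0, by simp, fun h => by simpa using congrFun h 0⟩, ?_, ?_, fun z hz => ?_⟩
  · rw [h2 0 (by simp)]; ext; simp
  · rw [h2 1 (by simp), mul_one, Real.sin_nat_mul_pi]; ext; simp
  · rw [h3 z (Ioo_subset_Icc_self hz)]
    ext i
    simp only [Pi.sub_apply, Pi.smul_apply, smul_eq_mul]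
    push_cast
    ring

theorem continuousOn_derivWithin_derivWithin {f : ℝ → ℝ} (hf : ContDiffOn ℝ 2 f (Icc 0 1)) :
    ContinuousOn (derivWithin (derivWithin f (Icc 0 1)) (Icc 0 1)) (Icc 0 1) :=
  (hf.derivWithin (m := 1) (uniqueDiffOn_Icc one_pos) (by norm_num)).continuousOn_derivWithin
    (uniqueDiffOn_Icc one_pos) le_rfl

/-- Green's formula against a test function. -/
theorem integral_derivWithin_derivWithin_mul {f φ : ℝ → ℝ} (hf : ContDiffOn ℝ 2 f (Icc 0 1))
    (hφ : IsTest φ) :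
    ∫ z in Ioo (0 : ℝ) 1, derivWithin (derivWithin f (Icc 0 1)) (Icc 0 1) z * φ z =
      derivWithin f (Icc 0 1) 1 * φ 1 - derivWithin f (Icc 0 1) 0 * φ 0 +
        ∫ z in Ioo (0 : ℝ) 1, f z * deriv (deriv φ) z := by
  have hu : UniqueDiffOn ℝ (Icc (0 : ℝ) 1) := uniqueDiffOn_Icc one_pos
  set f' := derivWithin f (Icc 0 1) with hf'
  set f'' := derivWithin f' (Icc 0 1) with hf''
  have hf'c : ContDiffOn ℝ 1 f' (Icc 0 1) := hf.derivWithin hu (by norm_num)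
  have hf''c : ContinuousOn f'' (Icc 0 1) := continuousOn_derivWithin_derivWithin hf
  have hφ1 : ContDiff ℝ 1 (deriv φ) := by
    have : ContDiff ℝ (1 + 1) φ := by simpa [one_add_one_eq_two] using hφ.smooth
    exact (contDiff_succ_iff_deriv.1 this).2.2
  have hφ2 : Continuous (deriv (deriv φ)) := hφ1.continuous_deriv le_rfl
  have hφd : ∀ z, HasDerivAt φ (deriv φ z) z := fun z =>
    (hφ.smooth.differentiable (by norm_num) z).hasDerivAt
  have hφd' : ∀ z, HasDerivAt (deriv φ) (deriv (deriv φ) z) z := fun z =>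
    (hφ1.differentiable (by norm_num) z).hasDerivAt
  have hi1 : IntegrableOn (fun z => f'' z * φ z) (Ioo 0 1) :=
    ((hf''c.mul hφ.smooth.continuous.continuousOn).integrableOn_compact isCompact_Icc).mono_set
      Ioo_subset_Icc_self
  have hi2 : IntegrableOn (fun z => f z * deriv (deriv φ) z) (Ioo 0 1) :=
    ((hf.continuousOn.mul hφ2.continuousOn).integrableOn_compact isCompact_Icc).mono_set
      Ioo_subset_Icc_self
  have key : ∫ z in (0 : ℝ)..1, (f'' z * φ z - f z * deriv (deriv φ) z) =
      (f' 1 * φ 1 - f 1 * deriv φ 1) - (f' 0 * φ 0 - f 0 * deriv φ 0) := by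
    refine intervalIntegral.integral_eq_sub_of_hasDerivAt_of_le (f := fun z =>
      f' z * φ z - f z * deriv φ z) zero_le_one ?_ ?_ ?_
    · exact (hf'c.continuousOn.mul hφ.smooth.continuous.continuousOn).sub
        (hf.continuousOn.mul hφ1.continuous.continuousOn)
    · intro z hz
      have hz' : Icc (0 : ℝ) 1 ∈ 𝓝 z := Icc_mem_nhds hz.1 hz.2
      have d1 : HasDerivAt f (f' z) z :=
        ((hf.differentiableOn (by norm_num)) z (Ioo_subset_Icc_self hz)).hasDerivWithinAt.hasDerivAt
          hz'
      have d2 : HasDerivAt f' (f'' z) z :=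
        ((hf'c.differentiableOn (by norm_num)) z
          (Ioo_subset_Icc_self hz)).hasDerivWithinAt.hasDerivAt hz'
      refine ((d2.mul (hφd z)).sub (d1.mul (hφd' z))).congr_deriv ?_
      ring
    · rw [intervalIntegrable_iff_integrableOn_Ioo_of_le zero_le_one]
      exact hi1.sub hi2
  rw [intervalIntegral.integral_of_le zero_le_one, integral_Ioc_eq_integral_Ioo,
    integral_sub hi1 hi2, hφ.left, hφ.right] at key
  linarith

section BoundaryValue

variable {κ : Type*} [Fintype κ] [DecidableEq κ]

theorem matrix_isUnit_of_notMem_cspec {F : Matrix κ κ ℝ} {r : ℝ} (hr : (r : ℂ) ∉ cspec F) :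
    IsUnit (Matrix.scalar κ r - F) := by
  have h := spectrum.notMem_iff.1 hr
  rw [Matrix.isUnit_iff_isUnit_det] at h ⊢
  have e : algebraMap ℂ (Matrix κ κ ℂ) (r : ℂ) - F.map (fun r : ℝ => (r : ℂ)) =
      (Matrix.scalar κ r - F).map Complex.ofRealHom := by
    ext i j
    by_cases hij : i = j
    · subst hij; simp [Matrix.algebraMap_matrix_apply]
    · simp [Matrix.algebraMap_matrix_apply, hij]
  rw [e, ← RingHom.mapMatrix_apply, ← RingHom.map_det] at h
  simpa using h

/-- The cosine coefficients of a solution are left null vectors of `F + μ + (k π)²`, which is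
invertible because `-(k π)² - μ` is a Neumann eigenvalue. -/
theorem eq_zero_of_homogeneous_neumann {m : ℕ} {μ : ℝ} {F : Matrix κ κ ℝ}
    (hc : neumannSpectrum (m + 1) μ ∩ cspec F = ∅) {y : ℝ → κ → ℝ}
    (hs : ∀ j, ContDiffOn ℝ 2 (fun z => y z j) (Icc 0 1))
    (hode : ∀ z ∈ Ioo (0 : ℝ) 1, ∀ j,
      derivWithin (derivWithin (fun z => y z j) (Icc 0 1)) (Icc 0 1) z =
        μ * y z j + (y z ᵥ* F) j)
    (h0 : ∀ j, derivWithin (fun z => y z j) (Icc 0 1) 0 = 0)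
    (h1 : ∀ j, derivWithin (fun z => y z j) (Icc 0 1) 1 = 0) :
    ∀ z ∈ Icc (0 : ℝ) 1, y z = 0 := by
  have hint : ∀ j, IntegrableOn (fun z => y z j) (Ioo 0 1) := fun j =>
    ((hs j).continuousOn.integrableOn_compact isCompact_Icc).mono_set Ioo_subset_Icc_self
  have hcoef : ∀ k : ℕ, ∀ j, ∫ z in Ioo (0 : ℝ) 1, y z j * Real.cos (k * Real.pi * z) = 0 := by
    intro k
    set c : κ → ℝ := fun j => ∫ z in Ioo (0 : ℝ) 1, y z j * Real.cos (k * Real.pi * z) with hcdef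
    have hintc : ∀ j, IntegrableOn (fun z => y z j * Real.cos (k * Real.pi * z)) (Ioo 0 1) :=
      fun j => integrableOn_Ioo_mul (hint j) (by fun_prop)
    have hu : IsUnit (Matrix.scalar κ (-((k : ℝ) * Real.pi) ^ 2 - μ) - F) := by
      refine matrix_isUnit_of_notMem_cspec fun h => ?_
      have : ((-((k : ℝ) * Real.pi) ^ 2 - μ : ℝ) : ℂ) ∈ neumannSpectrum (m + 1) μ ∩ cspec F :=
        ⟨neg_sq_sub_mem_neumannSpectrum m k μ, h⟩
      rw [hc] at this
      exact this
    have hnull : c ᵥ* (Matrix.scalar κ (-((k : ℝ) * Real.pi) ^ 2 - μ) - F) = 0 := by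
      ext j
      have g := integral_derivWithin_derivWithin_mul (hs j) (isTest_cos k)
      rw [h0, h1, deriv_deriv_cos] at g
      have e1 : ∫ z in Ioo (0 : ℝ) 1, y z j * (-((k : ℝ) * Real.pi) ^ 2 *
          Real.cos (k * Real.pi * z)) = -((k : ℝ) * Real.pi) ^ 2 * c j := by
        simp_rw [mul_left_comm (y _ j)]
        rw [integral_const_mul]
      have e2 : ∫ z in Ioo (0 : ℝ) 1,
          derivWithin (derivWithin (fun z => y z j) (Icc 0 1)) (Icc 0 1) z *
            Real.cos (k * Real.pi * z) = μ * c j + (c ᵥ* F) j := by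
        have e3 : ∀ z ∈ Ioo (0 : ℝ) 1,
            derivWithin (derivWithin (fun z => y z j) (Icc 0 1)) (Icc 0 1) z *
            Real.cos (k * Real.pi * z) = μ * (y z j * Real.cos (k * Real.pi * z)) +
              ∑ i, (y z i * Real.cos (k * Real.pi * z)) * F i j := by
          intro z hz
          rw [hode z hz j, add_mul, mul_assoc, Matrix.vecMul, dotProduct, Finset.sum_mul]
          congr 1
          exact Finset.sum_congr rfl fun i _ => by ring
        rw [setIntegral_congr_fun measurableSet_Ioo e3, integral_add, integral_const_mul,
          integral_finsetSum]
        · simp only [integral_mul_const]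
          rfl
        · exact fun i _ => (hintc i).mul_const _
        · exact (hintc j).const_mul _
        · exact integrable_finsetSum _ fun i _ => (hintc i).mul_const _
      rw [e1, e2] at g
      rw [Matrix.vecMul_sub]
      have e4 : (c ᵥ* Matrix.scalar κ (-((k : ℝ) * Real.pi) ^ 2 - μ)) j =
          c j * (-((k : ℝ) * Real.pi) ^ 2 - μ) := by
        simp [Matrix.vecMul_diagonal]
      rw [Pi.sub_apply, e4, Pi.zero_apply]
      linarith
    have : c = 0 := by
      obtain ⟨u, hu⟩ := hu
      rw [← hu] at hnull
      have h5 := congrArg (fun v => v ᵥ* (↑u⁻¹ : Matrix κ κ ℝ)) hnull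
      simpa only [Matrix.vecMul_vecMul, Units.mul_inv, Matrix.vecMul_one, Matrix.zero_vecMul]
        using h5
    exact fun j => congrFun this j
  intro z hz
  ext j
  have hae := ae_eq_zero_of_integral_cos_eq_zero (hint j) fun k => hcoef k j
  rw [Measure.restrict_congr_set Ioo_ae_eq_Icc] at hae
  exact Measure.eqOn_Icc_of_ae_eq (μ := volume) (f := fun z => y z j) (g := fun _ => (0 : ℝ))
    (by norm_num) hae (hs j).continuousOn continuousOn_const hz

/-- Rowwise existence by shooting: the initial value `y(0)` depends linearly on the end slope
`y'(1)`, and the shooting map is injective by uniqueness. -/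
theorem exists_neumann_solution {m : ℕ} {μ : ℝ} {F : Matrix κ κ ℝ}
    (hc : neumannSpectrum (m + 1) μ ∩ cspec F = ∅) (g : κ → ℝ) :
    ∃ y : ℝ → κ → ℝ, (∀ j, ContDiffOn ℝ 2 (fun z => y z j) (Icc 0 1)) ∧
      (∀ z ∈ Icc (0 : ℝ) 1, ∀ j,
        derivWithin (derivWithin (fun z => y z j) (Icc 0 1)) (Icc 0 1) z =
          μ * y z j + (y z ᵥ* F) j) ∧
      (∀ j, derivWithin (fun z => y z j) (Icc 0 1) 0 = 0) ∧
      ∀ j, derivWithin (fun z => y z j) (Icc 0 1) 1 = g j := by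
  -- the first-order system `(y, p)' = (p, μ y + y F)`
  let A : (κ → ℝ) × (κ → ℝ) →ₗ[ℝ] (κ → ℝ) × (κ → ℝ) :=
    (LinearMap.snd ℝ _ _).prod ((μ • LinearMap.id + F.vecMulLinear).comp (LinearMap.fst ℝ _ _))
  let L := LinearMap.toContinuousLinearMap A
  let w : (κ → ℝ) → ℝ → (κ → ℝ) × (κ → ℝ) := fun v z => NormedSpace.exp (z • L) (v, 0)
  have hw : ∀ v z, HasDerivAt (w v) ((w v z).2, μ • (w v z).1 + (w v z).1 ᵥ* F) z := fun v z =>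
    hasDerivAt_exp_smul_apply L (v, 0) z
  have hwc : ∀ v, Continuous (w v) := fun v =>
    continuous_iff_continuousAt.2 fun z => (hw v z).continuousAt
  have hw1 : ∀ v j z, HasDerivAt (fun z => (w v z).1 j) ((w v z).2 j) z := fun v j z =>
    hasDerivAt_pi.1 ((hw v z).fst) j
  have hw2 : ∀ v j z, HasDerivAt (fun z => (w v z).2 j)
      (μ * (w v z).1 j + ((w v z).1 ᵥ* F) j) z := fun v j z =>
    hasDerivAt_pi.1 ((hw v z).snd) j
  have hw0 : ∀ v, w v 0 = (v, 0) := fun v => by simp [w]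
  have hd := fun v j => contDiffOn_two_and_derivWithin (hw1 v j) (hw2 v j) (by
    have := hwc v
    have h1 : Continuous fun z => (w v z).1 := by fun_prop
    have h2 : Continuous fun z => (w v z).1 ᵥ* F := h1.matrix_vecMul continuous_const
    have h3 : ∀ j, Continuous fun z => (w v z).1 j := fun j => (continuous_apply j).comp h1
    have h4 : ∀ j, Continuous fun z => ((w v z).1 ᵥ* F) j := fun j => (continuous_apply j).comp h2
    exact ((h3 j).const_mul μ).add (h4 j))
  let Φ : (κ → ℝ) →ₗ[ℝ] (κ → ℝ) :=
    (LinearMap.snd ℝ _ _).comp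
      ((NormedSpace.exp ((1 : ℝ) • L) : _ →L[ℝ] _).toLinearMap.comp (LinearMap.inl ℝ _ _))
  have hΦ : ∀ v, Φ v = (w v 1).2 := fun v => rfl
  have hinj : Function.Injective Φ := by
    rw [← LinearMap.ker_eq_bot, LinearMap.ker_eq_bot']
    intro v hv
    have := eq_zero_of_homogeneous_neumann hc (y := fun z => (w v z).1) (fun j => (hd v j).1)
      (fun z hz j => (hd v j).2.2 z (Ioo_subset_Icc_self hz))
      (fun j => by rw [(hd v j).2.1 0 (by simp), hw0]; rfl)
      (fun j => by rw [(hd v j).2.1 1 (by simp), ← hΦ, hv]; rfl) 0 (by simp)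
    simpa [hw0] using this
  obtain ⟨v, hv⟩ := LinearMap.injective_iff_surjective.1 hinj g
  refine ⟨fun z => (w v z).1, fun j => (hd v j).1, fun z hz j => (hd v j).2.2 z hz,
    fun j => ?_, fun j => ?_⟩
  · rw [(hd v j).2.1 0 (by simp), hw0]; rfl
  · rw [(hd v j).2.1 1 (by simp), ← hΦ, hv]

theorem exists_solvesSigma {ι : Type*} {m : ℕ} {μ : ℝ} {F : Matrix κ κ ℝ}
    (hc : neumannSpectrum (m + 1) μ ∩ cspec F = ∅) (G : Matrix ι κ ℝ) :
    ∃ X, SolvesSigma μ F G X := by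
  choose y hy1 hy2 hy3 hy4 using fun i => exists_neumann_solution hc (G i)
  refine ⟨fun z => Matrix.of fun i => y i z, fun i j => hy1 i j, fun z hz => ?_, ?_, ?_⟩
  · ext i j
    have := hy2 i z (Ioo_subset_Icc_self hz) j
    simp only [Matrix.sub_apply, Matrix.smul_apply, Matrix.of_apply, smul_eq_mul, Matrix.zero_apply,
      matDeriv, this, Matrix.mul_apply, Matrix.vecMul, dotProduct]
    ring
  · ext i j
    exact hy3 i j
  · ext i j
    exact hy4 i j

theorem SolvesSigma.derivWithin_derivWithin {ι κ : Type*} [Fintype κ] {μ : ℝ} {F : Matrix κ κ ℝ}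
    {G : Matrix ι κ ℝ} {X : ℝ → Matrix ι κ ℝ} (h : SolvesSigma μ F G X) (i : ι) (j : κ) {z : ℝ}
    (hz : z ∈ Ioo (0 : ℝ) 1) :
    derivWithin (derivWithin (fun z => X z i j) (Icc 0 1)) (Icc 0 1) z =
      μ * X z i j + (X z * F) i j := by
  have := congrFun (congrFun (h.ode z hz) i) j
  simp only [Matrix.sub_apply, Matrix.smul_apply, smul_eq_mul, Matrix.zero_apply, matDeriv,
    Matrix.of_apply] at this
  linarith

theorem SolvesSigma.eqOn {ι : Type*} {m : ℕ} {μ : ℝ} {F : Matrix κ κ ℝ}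
    (hc : neumannSpectrum (m + 1) μ ∩ cspec F = ∅) {G : Matrix ι κ ℝ} {X X' : ℝ → Matrix ι κ ℝ}
    (h : SolvesSigma μ F G X) (h' : SolvesSigma μ F G X') :
    ∀ z ∈ Icc (0 : ℝ) 1, X z = X' z := by
  have hu : UniqueDiffOn ℝ (Icc (0 : ℝ) 1) := uniqueDiffOn_Icc one_pos
  intro z hz
  ext i j
  have hd : ∀ j, ∀ z ∈ Icc (0 : ℝ) 1,
      derivWithin (fun z => (X z i - X' z i) j) (Icc 0 1) z =
        derivWithin (fun z => X z i j) (Icc 0 1) z -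
          derivWithin (fun z => X' z i j) (Icc 0 1) z := fun j z hz =>
    derivWithin_fun_sub ((h.smooth i j).differentiableOn (by norm_num) z hz)
      ((h'.smooth i j).differentiableOn (by norm_num) z hz)
  have key := eq_zero_of_homogeneous_neumann hc (y := fun z => X z i - X' z i)
    (fun j => (h.smooth i j).sub (h'.smooth i j))
    (fun z hz j => by
      have hz' := Ioo_subset_Icc_self hz
      rw [derivWithin_congr (hd j) (hd j z hz'), derivWithin_fun_sub
        (((h.smooth i j).derivWithin (m := 1) hu (by norm_num)).differentiableOn (by norm_num) z hz')
        (((h'.smooth i j).derivWithin (m := 1) hu (by norm_num)).differentiableOn (by norm_num)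
          z hz'), h.derivWithin_derivWithin i j hz, h'.derivWithin_derivWithin i j hz,
        Matrix.sub_vecMul]
      simp only [Pi.sub_apply, Matrix.mul_apply, Matrix.vecMul, dotProduct]
      ring)
    (fun j => by
      have e1 := congrFun (congrFun h.left i) j
      have e2 := congrFun (congrFun h'.left i) j
      simp only [matDeriv, Matrix.of_apply, Matrix.zero_apply] at e1 e2
      rw [hd j 0 (by simp), e1, e2, sub_zero])
    (fun j => by
      have e1 := congrFun (congrFun h.right i) j
      have e2 := congrFun (congrFun h'.right i) j
      simp only [matDeriv, Matrix.of_apply] at e1 e2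
      rw [hd j 1 (by simp), e1, e2, sub_self]) z hz
  exact sub_eq_zero.1 (congrFun key j)

end BoundaryValue

/-! ### Weak solutions of the Neumann heat equation -/

theorem memLp_of_continuousOn_Icc {E : Type*} [NormedAddCommGroup E]
    [SecondCountableTopologyEither ℝ E] {g : ℝ → E} (hg : ContinuousOn g (Icc 0 1)) :
    MemLp g 2 (volume.restrict (Ioo (0 : ℝ) 1)) := by
  obtain ⟨C, hC⟩ := isCompact_Icc.exists_bound_of_continuousOn hg
  refine MemLp.of_bound ((hg.mono Ioo_subset_Icc_self).aestronglyMeasurable measurableSet_Ioo) C ?_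
  filter_upwards [ae_restrict_mem measurableSet_Ioo] with z hz
  exact hC z (Ioo_subset_Icc_self hz)

/-- The continuous functional `x ↦ ∫₀¹ xᵢ φ`. -/
noncomputable def pairing {N : ℕ} (i : Fin N) (φ : ℝ → ℝ) (hφ : Continuous φ) : L2 N →L[ℝ] ℝ :=
  innerSL ℝ ((memLp_of_continuousOn_Icc (g := fun z => φ z • EuclideanSpace.single i (1 : ℝ))
    (by fun_prop)).toLp _)

theorem pairing_apply {N : ℕ} (i : Fin N) (φ : ℝ → ℝ) (hφ : Continuous φ) (x : L2 N) :
    pairing i φ hφ x = ∫ z in Ioo (0 : ℝ) 1, x z i * φ z := by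
  rw [pairing, innerSL_apply_apply, L2.inner_def]
  refine integral_congr_ae ?_
  filter_upwards [MemLp.coeFn_toLp (memLp_of_continuousOn_Icc
    (g := fun z => φ z • EuclideanSpace.single i (1 : ℝ)) (by fun_prop))] with z hz
  rw [hz, inner_smul_left, EuclideanSpace.inner_single_left]
  simp [mul_comm]

theorem integrableOn_L2_apply {N : ℕ} (x : L2 N) (i : Fin N) :
    IntegrableOn (fun z => x z i) (Ioo 0 1) := by
  have h1 : MemLp x 1 (volume.restrict (Ioo (0 : ℝ) 1)) :=
    (Lp.memLp x).mono_exponent (by norm_num)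
  have h2 := memLp_one_iff_integrable.1 h1
  exact (EuclideanSpace.proj (𝕜 := ℝ) i).integrable_comp h2

theorem IsTest.continuous_deriv_deriv_sub {φ : ℝ → ℝ} (hφ : IsTest φ) (μ : ℝ) :
    Continuous fun z => deriv (deriv φ) z - μ * φ z := by
  have h : ContDiff ℝ (1 + 1) φ := by simpa [one_add_one_eq_two] using hφ.smooth
  exact ((contDiff_succ_iff_deriv.1 h).2.2.continuous_deriv le_rfl).sub
    (hφ.smooth.continuous.const_mul μ)

theorem isNeumannSolution_iff_pairing {N : ℕ} {μ : ℝ} {u : ℝ → Fin N → ℝ} {x : ℝ → L2 N} :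
    IsNeumannSolution μ u x ↔ ContinuousOn x (Ici 0) ∧
      ∀ φ (hφ : IsTest φ), ∀ i, ∀ t > (0 : ℝ),
        HasDerivAt (fun s => pairing i φ hφ.smooth.continuous (x s))
          (pairing i _ (hφ.continuous_deriv_deriv_sub μ) (x t) + u t i * φ 1) t := by
  simp only [pairing_apply]
  exact ⟨fun h => ⟨h.cont, h.weak⟩, fun h => ⟨h.1, h.2⟩⟩

theorem IsNeumannSolution.add {N : ℕ} {μ : ℝ} {u u' : ℝ → Fin N → ℝ} {x x' : ℝ → L2 N}
    (h : IsNeumannSolution μ u x) (h' : IsNeumannSolution μ u' x') :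
    IsNeumannSolution μ (fun t => u t + u' t) (fun t => x t + x' t) := by
  rw [isNeumannSolution_iff_pairing] at *
  refine ⟨h.1.add h'.1, fun φ hφ i t ht => ?_⟩
  simp only [map_add]
  refine ((h.2 φ hφ i t ht).add (h'.2 φ hφ i t ht)).congr_deriv ?_
  simp only [Pi.add_apply]
  ring

theorem IsNeumannSolution.const_smul {N : ℕ} {μ : ℝ} {u : ℝ → Fin N → ℝ} {x : ℝ → L2 N} (c : ℝ)
    (h : IsNeumannSolution μ u x) :
    IsNeumannSolution μ (fun t => c • u t) (fun t => c • x t) := by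
  rw [isNeumannSolution_iff_pairing] at *
  refine ⟨h.1.const_smul c, fun φ hφ i t ht => ?_⟩
  simp only [map_smul, smul_eq_mul]
  refine ((h.2 φ hφ i t ht).const_mul c).congr_deriv ?_
  simp only [Pi.smul_apply, smul_eq_mul]
  ring

theorem IsNeumannSolution.sub {N : ℕ} {μ : ℝ} {u u' : ℝ → Fin N → ℝ} {x x' : ℝ → L2 N}
    (h : IsNeumannSolution μ u x) (h' : IsNeumannSolution μ u' x') :
    IsNeumannSolution μ (fun t => u t - u' t) (fun t => x t - x' t) := by
  simpa [sub_eq_add_neg] using h.add (h'.const_smul (-1))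

theorem IsNeumannSolution.congr_input {N : ℕ} {μ : ℝ} {u u' : ℝ → Fin N → ℝ} {x : ℝ → L2 N}
    (h : IsNeumannSolution μ u x) (hu : ∀ t > (0 : ℝ), u t = u' t) : IsNeumannSolution μ u' x :=
  ⟨h.cont, fun φ hφ i t ht => by rw [← hu t ht]; exact h.weak φ hφ i t ht⟩

/-! ### Solutions generated by finite-dimensional signal models -/

section Sigma

variable {κ : Type*} [Fintype κ]

theorem continuousOn_toLp_mulVec {N : ℕ} {X : ℝ → Matrix (Fin N) κ ℝ}
    (hX : ∀ i j, ContinuousOn (fun z => X z i j) (Icc 0 1)) (v : κ → ℝ) :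
    ContinuousOn (fun z => (WithLp.toLp 2 (X z *ᵥ v) : EuclideanSpace ℝ (Fin N))) (Icc 0 1) := by
  refine (PiLp.continuous_toLp 2 _).comp_continuousOn (continuousOn_pi.2 fun i => ?_)
  exact continuousOn_finsetSum _ fun j _ => (hX i j).mul continuousOn_const

/-- The map `v ↦ X(·) v` from `ℝ^κ` to `L²(0,1)^N`. -/
noncomputable def profileMap {N : ℕ} (X : ℝ → Matrix (Fin N) κ ℝ)
    (hX : ∀ i j, ContinuousOn (fun z => X z i j) (Icc 0 1)) : (κ → ℝ) →L[ℝ] L2 N :=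
  LinearMap.toContinuousLinearMap
    { toFun := fun v => (memLp_of_continuousOn_Icc (continuousOn_toLp_mulVec hX v)).toLp _
      map_add' := fun v w => by
        rw [← MemLp.toLp_add]
        exact MemLp.toLp_congr _ _ (Eventually.of_forall fun z => by
          simp [Matrix.mulVec_add])
      map_smul' := fun c v => by
        rw [RingHom.id_apply, ← MemLp.toLp_const_smul]
        exact MemLp.toLp_congr _ _ (Eventually.of_forall fun z => by
          simp [Matrix.mulVec_smul]) }

theorem coeFn_profileMap {N : ℕ} (X : ℝ → Matrix (Fin N) κ ℝ)
    (hX : ∀ i j, ContinuousOn (fun z => X z i j) (Icc 0 1)) (v : κ → ℝ) :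
    profileMap X hX v =ᵐ[volume.restrict (Ioo (0 : ℝ) 1)] fun z => WithLp.toLp 2 (X z *ᵥ v) :=
  MemLp.coeFn_toLp (memLp_of_continuousOn_Icc (continuousOn_toLp_mulVec hX v))

theorem pairing_profileMap {N : ℕ} (X : ℝ → Matrix (Fin N) κ ℝ)
    (hX : ∀ i j, ContinuousOn (fun z => X z i j) (Icc 0 1)) (v : κ → ℝ) (i : Fin N) {φ : ℝ → ℝ}
    (hφ : Continuous φ) :
    pairing i φ hφ (profileMap X hX v) = ∫ z in Ioo (0 : ℝ) 1, (X z *ᵥ v) i * φ z := by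
  rw [pairing_apply]
  refine integral_congr_ae ?_
  filter_upwards [coeFn_profileMap X hX v] with z hz
  rw [hz]

theorem SolvesSigma.continuousOn {ι : Type*} {μ : ℝ} {F : Matrix κ κ ℝ} {G : Matrix ι κ ℝ}
    {X : ℝ → Matrix ι κ ℝ} (h : SolvesSigma μ F G X) (i : ι) (j : κ) :
    ContinuousOn (fun z => X z i j) (Icc 0 1) :=
  (h.smooth i j).continuousOn

/-- The weak form of `X'' v - μ X v = X F v`, `X'(1) v = G v`. -/
theorem SolvesSigma.pairing_profileMap {N : ℕ} {μ : ℝ} {F : Matrix κ κ ℝ} {G : Matrix (Fin N) κ ℝ}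
    {X : ℝ → Matrix (Fin N) κ ℝ} (h : SolvesSigma μ F G X) (v : κ → ℝ) (i : Fin N) {φ : ℝ → ℝ}
    (hφ : IsTest φ) :
    pairing i φ hφ.smooth.continuous (profileMap X h.continuousOn (F *ᵥ v)) =
      pairing i _ (hφ.continuous_deriv_deriv_sub μ) (profileMap X h.continuousOn v) +
        (G *ᵥ v) i * φ 1 := by
  have hφ2 : Continuous (deriv (deriv φ)) := by simpa using hφ.continuous_deriv_deriv_sub 0
  have hφc := hφ.smooth.continuous
  have hint : ∀ j, ∀ ψ : ℝ → ℝ, Continuous ψ → IntegrableOn (fun z => X z i j * ψ z) (Ioo 0 1) :=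
    fun j ψ hψ => ((h.continuousOn i j).mul hψ.continuousOn |>.integrableOn_compact
      isCompact_Icc).mono_set Ioo_subset_Icc_self
  have hgreen : ∀ j, ∫ z in Ioo (0 : ℝ) 1, (X z * F) i j * φ z =
      G i j * φ 1 + ∫ z in Ioo (0 : ℝ) 1, X z i j * (deriv (deriv φ) z - μ * φ z) := by
    intro j
    have g := integral_derivWithin_derivWithin_mul (h.smooth i j) hφ
    have e0 := congrFun (congrFun h.left i) j
    have e1 := congrFun (congrFun h.right i) j
    simp only [matDeriv, Matrix.of_apply, Matrix.zero_apply] at e0 e1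
    rw [e0, e1, zero_mul, sub_zero] at g
    have e2 : ∀ z ∈ Ioo (0 : ℝ) 1, (X z * F) i j * φ z =
        derivWithin (derivWithin (fun z => X z i j) (Icc 0 1)) (Icc 0 1) z * φ z -
          μ * (X z i j * φ z) := by
      intro z hz
      rw [h.derivWithin_derivWithin i j hz]
      ring
    have hint2 : IntegrableOn (fun z =>
        derivWithin (derivWithin (fun z => X z i j) (Icc 0 1)) (Icc 0 1) z * φ z) (Ioo 0 1) :=
      ((continuousOn_derivWithin_derivWithin (h.smooth i j)).mul hφc.continuousOn
        |>.integrableOn_compact isCompact_Icc).mono_set Ioo_subset_Icc_self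
    rw [setIntegral_congr_fun measurableSet_Ioo e2, integral_sub hint2 ((hint j φ hφc).const_mul μ),
      g, integral_const_mul]
    simp_rw [mul_sub, mul_left_comm _ μ]
    rw [integral_sub (hint j _ hφ2) ((hint j φ hφc).const_mul μ), integral_const_mul]
    ring
  have hXF : ∀ j, IntegrableOn (fun z => (X z * F) i j * φ z) (Ioo 0 1) := by
    intro j
    simp_rw [Matrix.mul_apply, Finset.sum_mul, mul_right_comm _ (F _ _)]
    exact integrable_finsetSum _ fun l _ => (hint l φ hφc).mul_const _
  rw [NetSync.pairing_profileMap, NetSync.pairing_profileMap]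
  simp_rw [Matrix.mulVec_mulVec, Matrix.mulVec, dotProduct, Finset.sum_mul, mul_right_comm _ (v _)]
  rw [integral_finsetSum _ fun j _ => (hXF j).mul_const _,
    integral_finsetSum _ fun j _ => (hint j _ (hφ.continuous_deriv_deriv_sub μ)).mul_const _,
    ← Finset.sum_add_distrib]
  refine Finset.sum_congr rfl fun j _ => ?_
  rw [integral_mul_const, integral_mul_const, hgreen]
  ring

/-- If `y' = F y`, then `X(z) y(t)` solves the heat equation with boundary input `G y(t)`. -/
theorem SolvesSigma.isNeumannSolution {N : ℕ} {μ : ℝ} {F : Matrix κ κ ℝ} {G : Matrix (Fin N) κ ℝ}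
    {X : ℝ → Matrix (Fin N) κ ℝ} (h : SolvesSigma μ F G X) {y : ℝ → κ → ℝ}
    (hc : ContinuousOn y (Ici 0)) (hy : ∀ t > (0 : ℝ), HasDerivAt y (F *ᵥ y t) t) :
    IsNeumannSolution μ (fun t => G *ᵥ y t) (fun t => profileMap X h.continuousOn (y t)) := by
  rw [isNeumannSolution_iff_pairing]
  refine ⟨(profileMap X h.continuousOn).continuous.comp_continuousOn hc, fun φ hφ i t ht => ?_⟩
  rw [← h.pairing_profileMap (y t) i hφ]
  exact ((pairing i φ hφ.smooth.continuous).comp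
    (profileMap X h.continuousOn)).hasFDerivAt.comp_hasDerivAt t (hy t ht)

end Sigma

/-! ### Solvability of the homogeneous Neumann heat equation -/

/-- Initial data for which the homogeneous Neumann heat equation has a solution. -/
def solvableData (N : ℕ) (μ : ℝ) : Submodule ℝ (L2 N) where
  carrier := {v | ∃ x, IsNeumannSolution μ (fun _ _ => 0) x ∧ x 0 = v}
  zero_mem' := ⟨fun _ => 0, isNeumannSolution_iff_pairing.2
    ⟨continuousOn_const, fun φ hφ i t _ => by simpa using hasDerivAt_const t (0 : ℝ)⟩, rfl⟩
  add_mem' := by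
    rintro _ _ ⟨x, hx, rfl⟩ ⟨x', hx', rfl⟩
    exact ⟨_, (hx.add hx').congr_input fun t _ => by ext; simp, rfl⟩
  smul_mem' := by
    rintro c _ ⟨x, hx, rfl⟩
    exact ⟨_, (hx.const_smul c).congr_input fun t _ => by ext; simp, rfl⟩

/-- By the stability estimate, solutions with convergent initial data converge uniformly in time,
and both sides of the weak formulation pass to the limit. -/
theorem isClosed_solvableData {N : ℕ} {μ : ℝ} (hstab : IsExpStable N μ) :
    IsClosed (solvableData N μ : Set (L2 N)) := by
  obtain ⟨M, hM, α, hα, hest⟩ := hstab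
  have hest' : ∀ x : ℝ → L2 N, IsNeumannSolution μ (fun _ _ => 0) x →
      ∀ t ≥ (0 : ℝ), ‖x t‖ ≤ M * ‖x 0‖ := by
    intro x hx t ht
    refine (hest x hx t ht).trans (mul_le_mul_of_nonneg_right ?_ (norm_nonneg _))
    have : Real.exp (-α * t) ≤ 1 := Real.exp_le_one_iff.2 (by nlinarith)
    nlinarith
  refine isClosed_of_closure_subset fun v hv => ?_
  obtain ⟨w, hw, hwv⟩ := mem_closure_iff_seq_limit.1 hv
  choose x hx hx0 using hw
  have hdiff : ∀ n k, ∀ t ≥ (0 : ℝ), ‖x n t - x k t‖ ≤ M * ‖w n - w k‖ := by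
    intro n k t ht
    have h := hest' _ (((hx n).sub (hx k)).congr_input fun t _ => by ext; simp) t ht
    rwa [hx0, hx0] at h
  have hlim : ∀ t ≥ (0 : ℝ), ∃ y, Tendsto (fun n => x n t) atTop (𝓝 y) := by
    intro t ht
    refine cauchySeq_tendsto_of_complete ?_
    rw [Metric.cauchySeq_iff']
    intro ε hε
    obtain ⟨K, hK⟩ := Metric.cauchySeq_iff'.1 hwv.cauchySeq (ε / M) (by positivity)
    refine ⟨K, fun n hn => ?_⟩
    rw [dist_eq_norm]
    refine (hdiff n K t ht).trans_lt ?_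
    have := hK n hn
    rw [dist_eq_norm, lt_div_iff₀ (by positivity)] at this
    linarith
  choose! X hX using hlim
  have hXle : ∀ n, ∀ t ≥ (0 : ℝ), ‖x n t - X t‖ ≤ M * ‖w n - v‖ := by
    intro n t ht
    refine le_of_tendsto_of_tendsto' (f := fun k => ‖x n t - x k t‖)
      (g := fun k => M * ‖w n - w k‖) (b := atTop) ?_ ?_ fun k => hdiff n k t ht
    · exact (tendsto_const_nhds.sub (hX t ht)).norm
    · exact ((tendsto_const_nhds.sub hwv).norm).const_mul M
  have hunif : TendstoUniformlyOn x X atTop (Ici 0) := by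
    rw [Metric.tendstoUniformlyOn_iff]
    intro ε hε
    have h0 : Tendsto (fun n => M * ‖w n - v‖) atTop (𝓝 0) := by
      have := ((hwv.sub_const v).norm).const_mul M
      simpa using this
    filter_upwards [h0.eventually (gt_mem_nhds hε)] with n hn t ht
    rw [dist_comm, dist_eq_norm]
    exact (hXle n t ht).trans_lt hn
  refine ⟨X, isNeumannSolution_iff_pairing.2 ⟨?_, fun φ hφ i t ht => ?_⟩, ?_⟩
  · exact hunif.continuousOn (Frequently.of_forall fun n => (hx n).cont)
  · have h2 : TendstoUniformlyOn
        (fun n s => pairing i _ (hφ.continuous_deriv_deriv_sub μ) (x n s))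
        (fun s => pairing i _ (hφ.continuous_deriv_deriv_sub μ) (X s)) atTop (Ioi 0) :=
      (pairing i _ (hφ.continuous_deriv_deriv_sub μ)).uniformContinuous.comp_tendstoUniformlyOn
        (hunif.mono Ioi_subset_Ici_self)
    have h3 := hasDerivAt_of_tendstoUniformlyOn isOpen_Ioi h2
      (f := fun n s => pairing i φ hφ.smooth.continuous (x n s))
      (g := fun s => pairing i φ hφ.smooth.continuous (X s))
      (Eventually.of_forall fun n s hs => by
        simpa using (isNeumannSolution_iff_pairing.1 (hx n)).2 φ hφ i s hs)
      (fun s hs => ((pairing i φ hφ.smooth.continuous).continuous.tendsto _).comp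
        (hX s (le_of_lt hs))) ht
    simpa using h3
  · refine tendsto_nhds_unique (hX 0 le_rfl) ?_
    simpa [hx0] using hwv

/-- The matrix profile of the cosine mode `cos (k π z) eᵢ`. -/
noncomputable def cosProfile {N : ℕ} (k : ℕ) (i : Fin N) (z : ℝ) : Matrix (Fin N) Unit ℝ :=
  Matrix.of fun i' _ => if i' = i then Real.cos (k * Real.pi * z) else 0

/-- The cosine mode as a profile with a scalar signal model and no boundary input. -/
theorem solvesSigma_cosProfile {N : ℕ} (μ : ℝ) (k : ℕ) (i : Fin N) :
    SolvesSigma μ (Matrix.of fun _ _ : Unit => -((k : ℝ) * Real.pi) ^ 2 - μ) 0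
      (cosProfile k i) := by
  obtain ⟨h1, h2, h3⟩ := contDiffOn_two_and_derivWithin (hasDerivAt_cos_mul (k * Real.pi))
    (hasDerivAt_neg_mul_sin_mul (k * Real.pi)) (by fun_prop)
  refine ⟨fun i' j => ?_, fun z hz => ?_, ?_, ?_⟩
  · by_cases h : i' = i
    · simpa [cosProfile, h] using h1
    · simpa [cosProfile, h] using contDiffOn_const
  · ext i' j
    by_cases h : i' = i
    · have := h3 z (Ioo_subset_Icc_self hz)
      simp [matDeriv, cosProfile, h, this, Matrix.mul_apply]
      ring
    · simp [matDeriv, cosProfile, h, Matrix.mul_apply]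
  · ext i' j
    by_cases h : i' = i
    · simp [matDeriv, cosProfile, h, h2]
    · simp [matDeriv, cosProfile, h]
  · ext i' j
    by_cases h : i' = i
    · simp [matDeriv, cosProfile, h, h2, Real.sin_nat_mul_pi]
    · simp [matDeriv, cosProfile, h]

/-- The solution is `exp (-((k π)² + μ) t) cos (k π z) eᵢ`. -/
theorem profileMap_cosProfile_mem {N : ℕ} (μ : ℝ) (k : ℕ) (i : Fin N) (v : Unit → ℝ) :
    profileMap (cosProfile k i) (solvesSigma_cosProfile μ k i).continuousOn v ∈
      solvableData N μ := by
  obtain ⟨y, hy0, hy⟩ := exists_hasDerivAt_mulVec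
    (Matrix.of fun _ _ : Unit => -((k : ℝ) * Real.pi) ^ 2 - μ) v
  refine ⟨_, ((solvesSigma_cosProfile μ k i).isNeumannSolution
    (fun t _ => (hy t).continuousAt.continuousWithinAt) fun t _ => hy t).congr_input
      fun t _ => ?_, ?_⟩
  · ext; simp
  · simp only [hy0]

/-- A datum orthogonal to all modes `cos (k π z) eᵢ`, which are solvable, vanishes; so the closed
subspace of solvable data is everything. -/
theorem solvableData_eq_top {N : ℕ} {μ : ℝ} (hstab : IsExpStable N μ) :
    solvableData N μ = ⊤ := by
  rw [← (isClosed_solvableData hstab).submodule_topologicalClosure_eq,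
    Submodule.topologicalClosure_eq_top_iff, Submodule.eq_bot_iff]
  intro f hf
  have hcomp : ∀ i, ∀ᵐ z ∂(volume.restrict (Ioo (0 : ℝ) 1)), f z i = 0 := by
    intro i
    refine ae_eq_zero_of_integral_cos_eq_zero (integrableOn_L2_apply f i) fun k => ?_
    have h := (Submodule.mem_orthogonal _ _).1 hf _ (profileMap_cosProfile_mem μ k i fun _ => 1)
    rw [L2.inner_def] at h
    refine Eq.trans (integral_congr_ae ?_) h
    filter_upwards [coeFn_profileMap (cosProfile k i)
      (solvesSigma_cosProfile μ k i).continuousOn fun _ => 1] with z hz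
    rw [hz, PiLp.inner_apply]
    simp [cosProfile, Matrix.mulVec, dotProduct]
  rw [Lp.eq_zero_iff_ae_eq_zero]
  filter_upwards [ae_all_iff.2 hcomp] with z hz
  ext i
  exact hz i

theorem exists_isNeumannSolution {N : ℕ} {μ : ℝ} (hstab : IsExpStable N μ) (v : L2 N) :
    ∃ x, IsNeumannSolution μ (fun _ _ => 0) x ∧ x 0 = v :=
  (solvableData_eq_top hstab).ge (Submodule.mem_top (x := v))

/-! ### The cascade -/

section Cascade

variable {m n : ℕ} {A : Matrix (Fin (m + 1)) (Fin (m + 1)) ℝ} {S : Matrix (Fin n) (Fin n) ℝ}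
  {q k : Fin n → ℝ} {μ : ℝ} {P : Matrix (Fin n) (Fin m × Fin n) ℝ}
  {X₁ : ℝ → Matrix (Fin (m + 1)) (Fin n) ℝ} {X₂ : ℝ → Matrix (Fin (m + 1)) (Fin m × Fin n) ℝ}
  {x : ℝ → L2 (m + 1)} {e : ℝ → Fin n → ℝ} {ε : ℝ → Fin m × Fin n → ℝ}

/-- The Sylvester equation decouples `e - P ε` from `ε`. -/
theorem SolvesTransform.mulVec_sub (h : SolvesTransform A S q k μ P X₁ X₂)
    (v : Fin n → ℝ) (w : Fin m × Fin n → ℝ) :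
    S *ᵥ v - coupling A q k *ᵥ w - P *ᵥ (Feps A S q k *ᵥ w) = S *ᵥ (v - P *ᵥ w) := by
  have hP : P * Feps A S q k = S * P - coupling A q k := by
    rw [sub_eq_iff_eq_add.1 h.sylvester]; abel
  rw [Matrix.mulVec_mulVec, hP, Matrix.sub_mulVec, Matrix.mulVec_sub, Matrix.mulVec_mulVec]
  abel

theorem IsCascadeSolution.continuousOn_sub_mulVec (hx : IsCascadeSolution A S q k μ x e ε)
    (P : Matrix (Fin n) (Fin m × Fin n) ℝ) : ContinuousOn (fun t => e t - P *ᵥ ε t) (Ici 0) :=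
  hx.e_cont.sub ((Continuous.matrix_mulVec continuous_const continuous_id).comp_continuousOn
    hx.eps_cont)

theorem IsCascadeSolution.hasDerivAt_sub_mulVec (hx : IsCascadeSolution A S q k μ x e ε)
    (h : SolvesTransform A S q k μ P X₁ X₂) {t : ℝ} (ht : 0 < t) :
    HasDerivAt (fun t => e t - P *ᵥ ε t) (S *ᵥ (e t - P *ᵥ ε t)) t :=
  ((hx.e_ode t ht).sub (hasDerivAt_const_mulVec P (hx.eps_ode t ht))).congr_deriv
    (h.mulVec_sub (e t) (ε t))

theorem oneK_mulVec_sub_add (P : Matrix (Fin n) (Fin m × Fin n) ℝ) (v : Fin n → ℝ)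
    (w : Fin m × Fin n → ℝ) :
    oneK m k *ᵥ (v - P *ᵥ w) + (oneK m k * P + Bmat m k) *ᵥ w =
      oneK m k *ᵥ v + Bmat m k *ᵥ w := by
  rw [Matrix.mulVec_sub, Matrix.add_mulVec, Matrix.mulVec_mulVec]
  abel

/-- Subtracting the profiles generated by the signal models removes the boundary input. -/
theorem IsCascadeSolution.isNeumannSolution_sub (hx : IsCascadeSolution A S q k μ x e ε)
    (h : SolvesTransform A S q k μ P X₁ X₂) :
    IsNeumannSolution μ (fun _ _ => 0) (fun t => x t -
      (profileMap X₁ h.sigma₁.continuousOn (e t - P *ᵥ ε t) +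
        profileMap X₂ h.sigma₂.continuousOn (ε t))) := by
  refine (hx.pde.sub ((h.sigma₁.isNeumannSolution (hx.continuousOn_sub_mulVec P)
    fun t ht => hx.hasDerivAt_sub_mulVec h ht).add
      (h.sigma₂.isNeumannSolution hx.eps_cont hx.eps_ode))).congr_input fun t _ => ?_
  rw [oneK_mulVec_sub_add, sub_self]
  rfl

/-- The solution is the sum of the two profiles and the homogeneous solution that corrects the
initial state. -/
theorem exists_isCascadeSolution (hstab : IsExpStable (m + 1) μ)
    (h : SolvesTransform A S q k μ P X₁ X₂) (x₀ : L2 (m + 1)) (e₀ : Fin n → ℝ)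
    (ε₀ : Fin m × Fin n → ℝ) :
    ∃ x e ε, IsCascadeSolution A S q k μ x e ε ∧ x 0 = x₀ ∧ e 0 = e₀ ∧ ε 0 = ε₀ := by
  obtain ⟨ε, hε0, hε⟩ := exists_hasDerivAt_mulVec (Feps A S q k) ε₀
  obtain ⟨y, hy0, hy⟩ := exists_hasDerivAt_mulVec S (e₀ - P *ᵥ ε₀)
  obtain ⟨r, hr, hr0⟩ := exists_isNeumannSolution hstab
    (x₀ - (profileMap X₁ h.sigma₁.continuousOn (e₀ - P *ᵥ ε₀) +
      profileMap X₂ h.sigma₂.continuousOn ε₀))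
  have hεc : ContinuousOn ε (Ici 0) := fun t _ => (hε t).continuousAt.continuousWithinAt
  have hyc : ContinuousOn y (Ici 0) := fun t _ => (hy t).continuousAt.continuousWithinAt
  have he : ∀ t, HasDerivAt (fun t => y t + P *ᵥ ε t)
      (S *ᵥ (y t + P *ᵥ ε t) - coupling A q k *ᵥ ε t) t := by
    intro t
    refine ((hy t).add (hasDerivAt_const_mulVec P (hε t))).congr_deriv ?_
    have := h.mulVec_sub (y t + P *ᵥ ε t) (ε t)
    rw [add_sub_cancel_right] at this
    rw [← this]
    abel
  refine ⟨fun t => r t + (profileMap X₁ h.sigma₁.continuousOn (y t) +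
    profileMap X₂ h.sigma₂.continuousOn (ε t)), fun t => y t + P *ᵥ ε t, ε,
    ⟨?_, fun t _ => (he t).continuousAt.continuousWithinAt, fun t _ => he t, hεc,
      fun t _ => hε t⟩, ?_, ?_, hε0⟩
  · refine (hr.add ((h.sigma₁.isNeumannSolution hyc fun t _ => hy t).add
      (h.sigma₂.isNeumannSolution hεc fun t _ => hε t))).congr_input fun t _ => ?_
    have := oneK_mulVec_sub_add (k := k) P (y t + P *ᵥ ε t) (ε t)
    rw [add_sub_cancel_right] at this
    rw [this]
    exact zero_add _
  · simp only [hr0, hy0, hε0, sub_add_cancel]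
  · simp only [hy0, hε0, sub_add_cancel]

theorem IsCascadeSolution.eq_of_initial_eq (hstab : IsExpStable (m + 1) μ)
    (h : SolvesTransform A S q k μ P X₁ X₂) (hx : IsCascadeSolution A S q k μ x e ε)
    {x' : ℝ → L2 (m + 1)} {e' : ℝ → Fin n → ℝ} {ε' : ℝ → Fin m × Fin n → ℝ}
    (hx' : IsCascadeSolution A S q k μ x' e' ε') (hx0 : x 0 = x' 0) (he0 : e 0 = e' 0)
    (hε0 : ε 0 = ε' 0) {t : ℝ} (ht : 0 ≤ t) : x t = x' t ∧ e t = e' t ∧ ε t = ε' t := by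
  have hε : ∀ t ≥ (0 : ℝ), ε t = ε' t := fun t ht =>
    eq_of_hasDerivAt_mulVec _ hx.eps_cont hx.eps_ode hx'.eps_cont hx'.eps_ode hε0 ht
  have he : ∀ t ≥ (0 : ℝ), e t = e' t := fun t ht => by
    have := eq_of_hasDerivAt_mulVec S (hx.continuousOn_sub_mulVec P)
      (fun t ht => hx.hasDerivAt_sub_mulVec h ht) (hx'.continuousOn_sub_mulVec P)
      (fun t ht => hx'.hasDerivAt_sub_mulVec h ht) (by simp only [he0, hε0]) ht
    simp only [hε t ht] at this
    exact sub_left_injective this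
  refine ⟨?_, he t ht, hε t ht⟩
  obtain ⟨M, _, α, _, hest⟩ := hstab
  have hd := hest _ ((hx.pde.sub hx'.pde).congr_input fun t ht => by
    rw [he t ht.le, hε t ht.le, sub_self]; rfl) t ht
  rw [hx0, sub_self, norm_zero, mul_zero] at hd
  exact sub_eq_zero.1 (norm_le_zero_iff.1 hd)

theorem IsCascadeSolution.exists_exp_decay_eps (hF : IsHurwitz (Feps A S q k))
    (hx : IsCascadeSolution A S q k μ x e ε) :
    ∃ b > (0 : ℝ), ∃ C, ∀ t ≥ (0 : ℝ), ‖ε t‖ ≤ C * Real.exp (-b * t) := by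
  obtain ⟨y, hy0, hy⟩ := exists_hasDerivAt_mulVec (Feps A S q k) (ε 0)
  obtain ⟨b, hb, C, hC⟩ := exists_exp_decay_of_isHurwitz hF hy
  refine ⟨b, hb, C, fun t ht => ?_⟩
  rw [eq_of_hasDerivAt_mulVec _ hx.eps_cont hx.eps_ode
    (fun t _ => (hy t).continuousAt.continuousWithinAt) (fun t _ => hy t) hy0.symm ht]
  exact hC t ht

theorem IsCascadeSolution.exists_norm_sub_mulVec_le (hS : IsDiagonalizable S)
    (him : ∀ s ∈ cspec S, s.re = 0) (h : SolvesTransform A S q k μ P X₁ X₂)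
    (hx : IsCascadeSolution A S q k μ x e ε) :
    ∃ C, ∀ t ≥ (0 : ℝ), ‖e t - P *ᵥ ε t‖ ≤ C := by
  obtain ⟨y, hy0, hy⟩ := exists_hasDerivAt_mulVec S (e 0 - P *ᵥ ε 0)
  obtain ⟨C, hC⟩ := exists_norm_le_of_isDiagonalizable hS him hy
  refine ⟨C, fun t ht => ?_⟩
  rw [eq_of_hasDerivAt_mulVec S (hx.continuousOn_sub_mulVec P)
    (fun t ht => hx.hasDerivAt_sub_mulVec h ht)
    (fun t _ => (hy t).continuousAt.continuousWithinAt) (fun t _ => hy t) hy0.symm ht]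
  exact hC t

theorem stateNorm_le {x : L2 (m + 1)} {e : Fin n → ℝ} {ε : Fin m × Fin n → ℝ} {a b c : ℝ}
    (hx : ‖x‖ ≤ a) (he : ‖e‖ ≤ b) (hε : ‖ε‖ ≤ c) :
    stateNorm x e ε ≤ √(a ^ 2 + ∑ _i : Fin n, b ^ 2 + ∑ _p : Fin m × Fin n, c ^ 2) := by
  refine Real.sqrt_le_sqrt (add_le_add (add_le_add ?_ ?_) ?_)
  · exact pow_le_pow_left₀ (norm_nonneg _) hx 2
  · refine Finset.sum_le_sum fun i _ => sq_le_sq' ?_ ?_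
    · exact neg_le_of_abs_le ((norm_le_pi_norm e i).trans he)
    · exact le_of_abs_le ((norm_le_pi_norm e i).trans he)
  · refine Finset.sum_le_sum fun i _ => sq_le_sq' ?_ ?_
    · exact neg_le_of_abs_le ((norm_le_pi_norm ε i).trans hε)
    · exact le_of_abs_le ((norm_le_pi_norm ε i).trans hε)

/-- The distance of `x` to the profile `X₁ (e - P ε)` is a homogeneous solution plus `X₂ ε`; both
decay. -/
theorem IsCascadeSolution.tendsto_sub_profileMap (hstab : IsExpStable (m + 1) μ)
    (hF : IsHurwitz (Feps A S q k)) (h : SolvesTransform A S q k μ P X₁ X₂)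
    (hx : IsCascadeSolution A S q k μ x e ε) :
    Tendsto (fun t => ‖x t - profileMap X₁ h.sigma₁.continuousOn (e t - P *ᵥ ε t)‖) atTop (𝓝 0) ∧
      ∃ C, ∀ t ≥ (0 : ℝ), ‖x t - profileMap X₁ h.sigma₁.continuousOn (e t - P *ᵥ ε t)‖ ≤ C := by
  obtain ⟨M, _, α, hα, hest⟩ := hstab
  obtain ⟨b, hb, C, hC⟩ := hx.exists_exp_decay_eps hF
  set T := profileMap X₂ h.sigma₂.continuousOn with hT
  have hr := hest _ (hx.isNeumannSolution_sub h)
  set r0 := ‖x 0 - (profileMap X₁ h.sigma₁.continuousOn (e 0 - P *ᵥ ε 0) + T (ε 0))‖ with hr0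
  have hb1 : ∀ t ≥ (0 : ℝ), ‖x t - profileMap X₁ h.sigma₁.continuousOn (e t - P *ᵥ ε t)‖ ≤
      M * r0 * Real.exp (-α * t) + ‖T‖ * C * Real.exp (-b * t) := by
    intro t ht
    have e1 : x t - profileMap X₁ h.sigma₁.continuousOn (e t - P *ᵥ ε t) =
        (x t - (profileMap X₁ h.sigma₁.continuousOn (e t - P *ᵥ ε t) + T (ε t))) + T (ε t) := by
      abel
    rw [e1]
    refine (norm_add_le _ _).trans (add_le_add ((hr t ht).trans_eq (by ring)) ?_)
    refine (T.le_opNorm _).trans ?_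
    rw [mul_assoc]
    exact mul_le_mul_of_nonneg_left (hC t ht) (norm_nonneg _)
  refine ⟨squeeze_zero' (Eventually.of_forall fun t => norm_nonneg _)
    ((eventually_ge_atTop 0).mono hb1) ?_, M * r0 + ‖T‖ * C, fun t ht => (hb1 t ht).trans ?_⟩
  · simpa using (tendsto_const_mul_exp_neg hα (M * r0)).add
      (tendsto_const_mul_exp_neg hb (‖T‖ * C))
  · have hC0 : 0 ≤ C := by simpa using (norm_nonneg _).trans (hC 0 le_rfl)
    have h1 : Real.exp (-α * t) ≤ 1 := Real.exp_le_one_iff.2 (by nlinarith)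
    have h2 : Real.exp (-b * t) ≤ 1 := Real.exp_le_one_iff.2 (by nlinarith)
    exact add_le_add (mul_le_of_le_one_right (by positivity) h1)
      (mul_le_of_le_one_right (by positivity) h2)

theorem IsCascadeSolution.exists_stateNorm_le (hS : IsDiagonalizable S)
    (him : ∀ s ∈ cspec S, s.re = 0) (hstab : IsExpStable (m + 1) μ)
    (hF : IsHurwitz (Feps A S q k)) (h : SolvesTransform A S q k μ P X₁ X₂)
    (hx : IsCascadeSolution A S q k μ x e ε) :
    ∃ C : ℝ, ∀ t ≥ (0 : ℝ), stateNorm (x t) (e t) (ε t) ≤ C := by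
  obtain ⟨C₁, hC₁⟩ := hx.exists_norm_sub_mulVec_le hS him h
  obtain ⟨b, hb, C₂, hC₂⟩ := hx.exists_exp_decay_eps hF
  obtain ⟨_, C₃, hC₃⟩ := hx.tendsto_sub_profileMap hstab hF h
  have hε : ∀ t ≥ (0 : ℝ), ‖ε t‖ ≤ C₂ := fun t ht =>
    le_of_exp_decay (f := fun t => ‖ε t‖) (norm_nonneg _) hb hC₂ ht
  set T := profileMap X₁ h.sigma₁.continuousOn
  set R : (Fin m × Fin n → ℝ) →L[ℝ] (Fin n → ℝ) := LinearMap.toContinuousLinearMap P.mulVecLin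
  refine ⟨_, fun t ht => stateNorm_le (a := C₃ + ‖T‖ * C₁) (b := C₁ + ‖R‖ * C₂) ?_ ?_ (hε t ht)⟩
  · have e1 : x t = (x t - T (e t - P *ᵥ ε t)) + T (e t - P *ᵥ ε t) := by abel
    rw [e1]
    refine (norm_add_le _ _).trans (add_le_add (hC₃ t ht) ((T.le_opNorm _).trans ?_))
    exact mul_le_mul_of_nonneg_left (hC₁ t ht) (norm_nonneg _)
  · have e1 : e t = (e t - P *ᵥ ε t) + R (ε t) := (sub_add_cancel _ _).symm
    rw [e1]
    refine (norm_add_le _ _).trans (add_le_add (hC₁ t ht) ((R.le_opNorm _).trans ?_))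
    exact mul_le_mul_of_nonneg_left (hε t ht) (norm_nonneg _)

end Cascade

end NetSync

theorem mainTheorem5 {m n : ℕ} (hm : 1 ≤ m)
    (A : Matrix (Fin (m + 1)) (Fin (m + 1)) ℝ)
    (hA_nonneg : ∀ i j, 0 ≤ A i j) (hA_diag : ∀ i, A i i = 0)
    (S : Matrix (Fin n) (Fin n) ℝ)
    (hS_diag : NetSync.IsDiagonalizable S) (hS_imag : ∀ s ∈ NetSync.cspec S, s.re = 0)
    (q k : Fin n → ℝ) (μ : ℝ)
    (hFS : NetSync.cspec (NetSync.Feps A S q k) ∩ NetSync.cspec S = ∅)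
    (hcS : NetSync.neumannSpectrum (m + 1) μ ∩ NetSync.cspec S = ∅)
    (hcF : NetSync.neumannSpectrum (m + 1) μ ∩ NetSync.cspec (NetSync.Feps A S q k) = ∅)
    (hstab : NetSync.IsExpStable (m + 1) μ)
    (hHurwitz : NetSync.IsHurwitz (NetSync.Feps A S q k)) :
    ∃ (P : Matrix (Fin n) (Fin m × Fin n) ℝ)
      (X₁ : ℝ → Matrix (Fin (m + 1)) (Fin n) ℝ)
      (X₂ : ℝ → Matrix (Fin (m + 1)) (Fin m × Fin n) ℝ),
      -- `P`, `X₁`, `X₂` are the unique solution of the transformation equations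
      NetSync.SolvesTransform A S q k μ P X₁ X₂ ∧
      (∀ P' X₁' X₂', NetSync.SolvesTransform A S q k μ P' X₁' X₂' →
        P' = P ∧ ∀ z ∈ Set.Icc (0 : ℝ) 1, X₁' z = X₁ z ∧ X₂' z = X₂ z) ∧
      -- every initial state has exactly one solution
      (∀ (x₀ : NetSync.L2 (m + 1)) (e₀ : Fin n → ℝ) (ε₀ : Fin m × Fin n → ℝ),
        (∃ x e ε, NetSync.IsCascadeSolution A S q k μ x e ε ∧ x 0 = x₀ ∧ e 0 = e₀ ∧ ε 0 = ε₀) ∧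
        ∀ x e ε x' e' ε', NetSync.IsCascadeSolution A S q k μ x e ε →
          x 0 = x₀ → e 0 = e₀ → ε 0 = ε₀ →
          NetSync.IsCascadeSolution A S q k μ x' e' ε' →
          x' 0 = x₀ → e' 0 = e₀ → ε' 0 = ε₀ →
          ∀ t ≥ (0 : ℝ), x t = x' t ∧ e t = e' t ∧ ε t = ε' t) ∧
      -- every solution is bounded, and its PDE part converges to `X₁(z) (e(t) - P ε(t))`
      (∀ x e ε, NetSync.IsCascadeSolution A S q k μ x e ε →
        (∃ C : ℝ, ∀ t ≥ (0 : ℝ), NetSync.stateNorm (x t) (e t) (ε t) ≤ C) ∧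
        Filter.Tendsto
          (fun t => MeasureTheory.eLpNorm
            (fun z => (x t : ℝ → EuclideanSpace ℝ (Fin (m + 1))) z -
              WithLp.toLp 2 (X₁ z *ᵥ (e t - P *ᵥ ε t)))
            2 (MeasureTheory.volume.restrict (Set.Ioo (0 : ℝ) 1)))
          Filter.atTop (nhds 0)) := by
  obtain ⟨P, hP, hPu⟩ := NetSync.existsUnique_sylvester hFS (-NetSync.coupling A q k)
  obtain ⟨X₁, hX₁⟩ := NetSync.exists_solvesSigma hcS (NetSync.oneK m k)
  obtain ⟨X₂, hX₂⟩ := NetSync.exists_solvesSigma hcF (NetSync.oneK m k * P + NetSync.Bmat m k)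
  have h : NetSync.SolvesTransform A S q k μ P X₁ X₂ := ⟨hP, hX₁, hX₂⟩
  refine ⟨P, X₁, X₂, h, fun P' X₁' X₂' h' => ?_, fun x₀ e₀ ε₀ =>
    ⟨NetSync.exists_isCascadeSolution hstab h x₀ e₀ ε₀, ?_⟩, fun x e ε hx =>
    ⟨hx.exists_stateNorm_le hS_diag hS_imag hstab hHurwitz h, ?_⟩⟩
  · obtain rfl : P' = P := hPu P' h'.sylvester
    exact ⟨rfl, fun z hz => ⟨h'.sigma₁.eqOn hcS hX₁ z hz, h'.sigma₂.eqOn hcF hX₂ z hz⟩⟩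
  · intro x e ε x' e' ε' hx hx0 he0 hε0 hx' hx0' he0' hε0' t ht
    exact hx.eq_of_initial_eq hstab h hx' (hx0.trans hx0'.symm) (he0.trans he0'.symm)
      (hε0.trans hε0'.symm) ht
  · have hlim := ENNReal.tendsto_ofReal (hx.tendsto_sub_profileMap hstab hHurwitz h).1
    rw [ENNReal.ofReal_zero] at hlim
    refine hlim.congr fun t => ?_
    rw [ofReal_norm, Lp.enorm_def]
    refine eLpNorm_congr_ae ?_
    filter_upwards [Lp.coeFn_sub (x t)
        (NetSync.profileMap X₁ h.sigma₁.continuousOn (e t - P *ᵥ ε t)),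
      NetSync.coeFn_profileMap X₁ h.sigma₁.continuousOn (e t - P *ᵥ ε t)] with z h1 h2
    rw [h1, Pi.sub_apply, h2]
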